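/- **Setting.** Let $d\ge 1$. Let $\mathcal S_d$ be the set of $\phi:\mathbb Z^d\to\mathbb C$ with $\sum_{x\in\mathbb Z^d}|x^\beta\phi(x)|<\infty$ for every multi-index $\beta\in\mathbb N^d$. Put $\widehat\phi(\xi)=\sum_{x\in\mathbb Z^d}\phi(x)e^{ix\cdot\xi}$ for $\xi\in\mathbb R^d$. The convolution powers are $\phi^{(1)}=\phi$ and $\phi^{(n+1)}=\phi^{(n)}*\phi$, where $(\psi*\phi)(x)=\sum_{y\in\mathbb Z^d}\psi(x-y)\phi(y)$. If $\sup_\xi|\widehat\phi(\xi)|=1$, let $\Omega(\phi)=\{\xi\in(-\pi,\pi]^d:|\widehat\phi(\xi)|=1\}$. **Homogeneity.** For an endomorphism $E$ of $\mathbb R^d$ and $r>0$ let $r^E=\exp((\ln r)E)$; $\{r^E\}$ is contracting if $\|r^E\|\to0$ as $r\to0^+$. A function $P:\mathbb R^d\to\mathbb R$ is homogeneous with respect to $E$ if $rP(x)=P(r^Ex)$ for all $r>0$ and $x\in\mathbb R^d$; the set of such $E$ is denoted $\operatorname{Exp}(P)$. $P$ is positive homogeneous if it is continuous, $P\ge0$,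 $P(x)=0$ only for $x=0$, $\operatorname{Exp}(P)\ne\varnothing$, and $\{r^E\}$ is contracting for each $E\in\operatorname{Exp}(P)$; then $\operatorname{tr}E$ is the same for all $E\in\operatorname{Exp}(P)$ and is denoted $\mu_P$. Let $\{r^E\}$ be contracting and let $f$ be a function on an open neighbourhood $\mathcal U$ of $0$. If $f$ is continuous, it is subhomogeneous with respect to $E$ if for every $\epsilon>0$ and compact $K\subseteq\mathbb R^d$ there is $\delta>0$ with $|f(r^E\xi)|\le\epsilon r$ for all $0<r<\delta$, $\xi\in K$. If $f\in C^l(\mathcal U)$, it is strongly subhomogeneous with respect to $E$ of order $l\ge1$ if for every $\epsilon>0$ and compact $K$ there is $\delta>0$ with $|r^j\partial_r^j f(r^E\xi)|\le\epsilon r$ for all $1\le j\le l$, $0<r<\delta$, $\xi\in K$. **Types.** Let $\phi\in\mathcal S_d$ with $\sup|\widehat\phi|=1$ and let $\xi_0\in\Omega(\phi)$. On small convex open neighbourhoods $\mathcal U$ of $0$ put $\Gamma_{\xi_0}(\xi)=\log\big(\widehat\phi(\xi+\xi_0)/\widehat\phi(\xi_0)\big)$ (principal branch). The drift $\alpha_{\xi_0}\in\mathbb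 R^d$ is the vector for which $i\alpha_{\xi_0}\cdot\xi$ is the linear term of the Taylor expansion of $\Gamma_{\xi_0}$ at $0$. Consider expansions $$\Gamma_{\xi_0}(\xi)=i\alpha_{\xi_0}\cdot\xi-i\big(Q(\xi)+\widetilde Q(\xi)\big)-\big(R(\xi)+\widetilde R(\xi)\big),\qquad \xi\in\mathcal U,$$ where $Q,R$ are real polynomials without constant and linear terms and $\widetilde Q,\widetilde R$ are real-valued, smooth on $\mathcal U$ and vanish at $0$. * $\xi_0$ is of *positive homogeneous type* if there is such an expansion in which $R$ is positive homogeneous and, for some $E\in\operatorname{Exp}(R)$, $Q$ is homogeneous with respect to $E$ and $\widetilde R,\widetilde Q$ are subhomogeneous with respect to $E$. Its homogeneous order is $\mu_{\xi_0}=\mu_R$. * $\xi_0$ is of *imaginary homogeneous type* if there is such an expansion in which $|Q|$ and $R$ are positive homogeneous and, for some $E\in\operatorname{Exp}(|Q|)$ and $k>1$, $R$ is homogeneous with respect to $E/k$, $\widetilde Q$ is strongly subhomogeneous with respect to $E$ of order $2$, and $\widetilde R$ is strongly subhomogeneous with respect to $E/k$ of order $1$. Its homogeneous order is $\mu_{\xi_0}=\mu_{|Q|}$.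 **Theorem.** Let $\phi\in\mathcal S_d$ be such that $\sup|\widehat\phi|=1$, and suppose that each $\xi_0\in\Omega(\phi)$ is of positive homogeneous or imaginary homogeneous type. Suppose further that $\alpha_{\xi_0}=0$ and $\mu_{\xi_0}<1$ for each $\xi_0\in\Omega(\phi)$ of imaginary homogeneous type. Then $\Omega(\phi)$ is finite, $\mu_\phi=\min_{\xi\in\Omega(\phi)}\mu_\xi$ exists, and for each compact set $K\subseteq\mathbb R^d$ there is a constant $C_K>0$ for which $$|\phi^{(n)}(x)|\le\frac{C_K}{n^{\mu_\phi}}\qquad\text{for all }x\in K\cap\mathbb Z^d\text{ and all integers }n\ge1.$$ -/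

import Mathlib

open scoped Topology ContDiff

namespace ConvPower

/-- Euclidean space `ℝ^d`. -/
abbrev E (d : ℕ) : Type := EuclideanSpace ℝ (Fin d)

/-- Endomorphisms of `ℝ^d`, with the operator norm. -/
abbrev End (d : ℕ) : Type := E d →L[ℝ] E d

/-! ### One-parameter groups and homogeneity -/

/-- `r ^ A = exp ((log r) A)` for `r > 0` and an endomorphism `A` of `ℝ^d`. -/
noncomputable def opPow {d : ℕ} (r : ℝ) (A : End d) : End d :=
  NormedSpace.exp (Real.log r • A)

/-- The group `r ↦ r ^ A` is contracting: `‖r ^ A‖ → 0` as `r → 0⁺`. -/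
def IsContracting {d : ℕ} (A : End d) : Prop :=
  Filter.Tendsto (fun r : ℝ => ‖opPow r A‖) (𝓝[>] 0) (𝓝 0)

/-- The trace of an endomorphism. -/
noncomputable def tr {d : ℕ} (A : End d) : ℝ :=
  LinearMap.trace ℝ (E d) (A : E d →ₗ[ℝ] E d)

/-- `P` is homogeneous with respect to `A`: `r P(x) = P(r ^ A x)` for all `r > 0` and `x`. -/
def IsHomogeneousWrt {d : ℕ} (P : E d → ℝ) (A : End d) : Prop :=
  ∀ r : ℝ, 0 < r → ∀ x : E d, r * P x = P (opPow r A x)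

/-- The exponent set `Exp(P)`. -/
def expSet {d : ℕ} (P : E d → ℝ) : Set (End d) :=
  {A | IsHomogeneousWrt P A}

/-- `P` is non-negative and vanishes only at `0`. -/
def IsPosDef {d : ℕ} (P : E d → ℝ) : Prop :=
  (∀ x, 0 ≤ P x) ∧ ∀ x, P x = 0 → x = 0

/-- Positive homogeneous functions: continuous, positive definite, `Exp(P)` is non-empty, and
`r ^ A` is contracting for each `A ∈ Exp(P)`. (For continuous positive definite `P` with
`Exp(P) ≠ ∅` the last condition is equivalent to compactness of `{P = 1}`, to `P(x) → ∞` as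
`x → ∞`, and to `r ^ A` being contracting for some `A ∈ Exp(P)`.) -/
structure IsPositiveHomogeneous {d : ℕ} (P : E d → ℝ) : Prop where
  continuous : Continuous P
  posDef : IsPosDef P
  nonempty : (expSet P).Nonempty
  contracting : ∀ A ∈ expSet P, IsContracting A

/-- `f`, continuous on a neighbourhood `O` of `0`, is subhomogeneous with respect to `A`.
The values of `f` outside `O` play no role when `r ^ A` is contracting. -/
def IsSubhomogeneous {d : ℕ} (O : Set (E d)) (f : E d → ℝ) (A : End d) : Prop :=
  ContinuousOn f O ∧
    ∀ ε : ℝ, 0 < ε → ∀ K : Set (E d), IsCompact K →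
      ∃ δ : ℝ, 0 < δ ∧ ∀ r : ℝ, 0 < r → r < δ → ∀ x ∈ K, |f (opPow r A x)| ≤ ε * r

/-- `f ∈ C^l(O)` is strongly subhomogeneous with respect to `A` of order `l`. -/
def IsStronglySubhomogeneous {d : ℕ} (l : ℕ) (O : Set (E d)) (f : E d → ℝ) (A : End d) : Prop :=
  ContDiffOn ℝ l f O ∧
    ∀ ε : ℝ, 0 < ε → ∀ K : Set (E d), IsCompact K →
      ∃ δ : ℝ, 0 < δ ∧ ∀ j : ℕ, 1 ≤ j → j ≤ l → ∀ r : ℝ, 0 < r → r < δ → ∀ x ∈ K,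
        |r ^ j * iteratedDeriv j (fun s : ℝ => f (opPow s A x)) r| ≤ ε * r

/-! ### Convolution powers and the Fourier transform on `ℤ^d` -/

/-- The point of `ℝ^d` given by a lattice point. -/
noncomputable def latticePt {d : ℕ} (x : Fin d → ℤ) : E d :=
  WithLp.toLp 2 (fun i => (x i : ℝ))

/-- The class `𝓢_d`: all moments `∑ₓ |x^β φ(x)|` are finite. -/
def MemS {d : ℕ} (φ : (Fin d → ℤ) → ℂ) : Prop :=
  ∀ β : Fin d → ℕ, Summable (fun x : Fin d → ℤ => ‖(∏ i, (x i : ℂ) ^ β i) * φ x‖)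

/-- Convolution on `ℤ^d`. -/
noncomputable def conv {d : ℕ} (ψ φ : (Fin d → ℤ) → ℂ) : (Fin d → ℤ) → ℂ :=
  fun x => ∑' y : Fin d → ℤ, ψ (x - y) * φ y

/-- The `n`-fold convolution power: `φ⁽⁰⁾ = δ₀`, `φ⁽ⁿ⁺¹⁾ = φ⁽ⁿ⁾ * φ`; so `φ⁽¹⁾ = φ`. -/
noncomputable def convPow {d : ℕ} (φ : (Fin d → ℤ) → ℂ) : ℕ → (Fin d → ℤ) → ℂ
  | 0 => Pi.single 0 1
  | n + 1 => conv (convPow φ n) φ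

/-- The Fourier transform `∑ₓ φ(x) e^{i x·ξ}`. -/
noncomputable def fourier {d : ℕ} (φ : (Fin d → ℤ) → ℂ) (ξ : E d) : ℂ :=
  ∑' x : Fin d → ℤ, φ x * Complex.exp (Complex.I * ((inner ℝ (latticePt x) ξ : ℝ) : ℂ))

/-- `Ω(φ)`: the points of `(-π, π]^d` at which the Fourier transform has modulus `1`. -/
def maxSet {d : ℕ} (φ : (Fin d → ℤ) → ℂ) : Set (E d) :=
  {ξ | (∀ i, ξ i ∈ Set.Ioc (-Real.pi) Real.pi) ∧ ‖fourier φ ξ‖ = 1}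

/-! ### Local expansions at points of `Ω(φ)` -/

/-- `Γ_{ξ₀}(ξ) = log (φ̂(ξ + ξ₀) / φ̂(ξ₀))`, principal branch. -/
noncomputable def logRatio {d : ℕ} (φ : (Fin d → ℤ) → ℂ) (ξ₀ ξ : E d) : ℂ :=
  Complex.log (fourier φ (ξ + ξ₀) / fourier φ ξ₀)

/-- The drift `α_{ξ₀}`: the vector for which `i α·ξ` is the linear Taylor term of `Γ_{ξ₀}` at `0`
(whose real part vanishes as `|φ̂|` is maximal at `ξ₀`). -/
noncomputable def drift {d : ℕ} (φ : (Fin d → ℤ) → ℂ) (ξ₀ : E d) : E d :=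
  gradient (fun ξ => (logRatio φ ξ₀ ξ).im) 0

/-- The function on `ℝ^d` defined by a real polynomial in `d` variables. -/
noncomputable def polyFun {d : ℕ} (p : MvPolynomial (Fin d) ℝ) : E d → ℝ :=
  fun ξ => MvPolynomial.eval (fun i => ξ i) p

/-- `p` vanishes at `0` and has no linear terms. -/
def NoLowTerms {d : ℕ} (p : MvPolynomial (Fin d) ℝ) : Prop :=
  MvPolynomial.coeff 0 p = 0 ∧ ∀ i : Fin d, MvPolynomial.coeff (Finsupp.single i 1) p = 0

/-- The expansion `Γ_{ξ₀}(ξ) = i α·ξ - i (Q(ξ) + Q'(ξ)) - (R(ξ) + R'(ξ))` on a convex open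
neighbourhood `U` of `0` on which the principal logarithm is continuous, where `α` is the drift,
`Q`, `R` are real polynomials without constant and linear terms, and the remainders `Q'`, `R'`
are real-valued, smooth on `U` and vanish at `0`. -/
structure IsExpansion {d : ℕ} (φ : (Fin d → ℤ) → ℂ) (ξ₀ : E d) (U : Set (E d))
    (Q R : MvPolynomial (Fin d) ℝ) (Q' R' : E d → ℝ) : Prop where
  isOpen : IsOpen U
  convex : Convex ℝ U
  zero_mem : (0 : E d) ∈ U
  mem_slitPlane : ∀ ξ ∈ U, fourier φ (ξ + ξ₀) / fourier φ ξ₀ ∈ Complex.slitPlane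
  noLowTerms_Q : NoLowTerms Q
  noLowTerms_R : NoLowTerms R
  smooth_Q' : ContDiffOn ℝ ∞ Q' U
  smooth_R' : ContDiffOn ℝ ∞ R' U
  Q'_zero : Q' 0 = 0
  R'_zero : R' 0 = 0
  eq : ∀ ξ ∈ U, logRatio φ ξ₀ ξ =
    Complex.I * ((inner ℝ (drift φ ξ₀) ξ : ℝ) : ℂ)
      - Complex.I * ((polyFun Q ξ + Q' ξ : ℝ) : ℂ) - ((polyFun R ξ + R' ξ : ℝ) : ℂ)

/-- `ξ₀` is of positive homogeneous type for `φ̂`, with homogeneous order `μ = μ_R = tr A`. -/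
def HasPositiveHomogeneousType {d : ℕ} (φ : (Fin d → ℤ) → ℂ) (ξ₀ : E d) (μ : ℝ) : Prop :=
  ∃ (U : Set (E d)) (Q R : MvPolynomial (Fin d) ℝ) (Q' R' : E d → ℝ),
    IsExpansion φ ξ₀ U Q R Q' R' ∧
    IsPositiveHomogeneous (polyFun R) ∧
    ∃ A ∈ expSet (polyFun R),
      IsHomogeneousWrt (polyFun Q) A ∧
      IsSubhomogeneous U R' A ∧
      IsSubhomogeneous U Q' A ∧
      μ = tr A

/-- `ξ₀` is of imaginary homogeneous type for `φ̂`, with homogeneous order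
`μ = μ_{|Q|} = tr A`. -/
def HasImaginaryHomogeneousType {d : ℕ} (φ : (Fin d → ℤ) → ℂ) (ξ₀ : E d) (μ : ℝ) : Prop :=
  ∃ (U : Set (E d)) (Q R : MvPolynomial (Fin d) ℝ) (Q' R' : E d → ℝ),
    IsExpansion φ ξ₀ U Q R Q' R' ∧
    IsPositiveHomogeneous (fun ξ => |polyFun Q ξ|) ∧
    IsPositiveHomogeneous (polyFun R) ∧
    ∃ A ∈ expSet (fun ξ => |polyFun Q ξ|), ∃ k : ℝ, 1 < k ∧
      IsHomogeneousWrt (polyFun R) (k⁻¹ • A) ∧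
      IsStronglySubhomogeneous 2 U Q' A ∧
      IsStronglySubhomogeneous 1 U R' (k⁻¹ • A) ∧
      μ = tr A

/-- `ξ₀` is of positive homogeneous type for `φ̂`. -/
def IsPositiveHomogeneousType {d : ℕ} (φ : (Fin d → ℤ) → ℂ) (ξ₀ : E d) : Prop :=
  ∃ μ, HasPositiveHomogeneousType φ ξ₀ μ

/-- `ξ₀` is of imaginary homogeneous type for `φ̂`. -/
def IsImaginaryHomogeneousType {d : ℕ} (φ : (Fin d → ℤ) → ℂ) (ξ₀ : E d) : Prop :=
  ∃ μ, HasImaginaryHomogeneousType φ ξ₀ μ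

open Classical in
/-- The homogeneous order `μ_{ξ₀}` of a point of positive or imaginary homogeneous type. The
number is the same for all admissible expansions and exponents: `tr A` is the rate in
`vol {|P| < t} = c t ^ (tr A)`, where `P` is the leading part `R`, resp. `Q`, and the leading
parts of two admissible expansions are asymptotic to each other at `0`.
(It is set to `0` at points of neither type.) -/
noncomputable def homogeneousOrder {d : ℕ} (φ : (Fin d → ℤ) → ℂ) (ξ₀ : E d) : ℝ :=
  if h : ∃ μ, HasPositiveHomogeneousType φ ξ₀ μ ∨ HasImaginaryHomogeneousType φ ξ₀ μ then
    h.choose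
  else 0

/-- `μ_φ`, the minimum of the homogeneous orders of the points of `Ω(φ)`. -/
noncomputable def minOrder {d : ℕ} (φ : (Fin d → ℤ) → ℂ) : ℝ :=
  sInf (homogeneousOrder φ '' maxSet φ)

end ConvPower

namespace ConvPower

open MeasureTheory Set Filter

/-!
Fourier inversion over a cube of periods writes `φ⁽ⁿ⁾(x)` as an integral of `φ̂(ξ)ⁿ e^{-ix·ξ}`.
Away from the points where `|φ̂| = 1`, which are isolated, the integrand decays geometrically, so
only neighbourhoods of these points matter.

At a point of positive homogeneous type `|φ̂|ⁿ ≤ exp (-n R / 2)`, and the substitution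
`ξ ↦ n^{-A} ξ` shows that this integrates to a multiple of `n ^ (-tr A)`.

At a point of imaginary homogeneous type the region `|Q| < b / n` has volume a multiple of
`n ^ (-tr A)`. The rest is integrated along the orbits `t ↦ t^A y`, on which `n Q` is `n t Q(y)`:
the phase has derivative of size `n`, and integrating by parts as in van der Corput's lemma gains
a factor `1 / n`. The assumption `tr A < 1` makes the remaining radial integral of
`t ^ (tr A - 2)` over `t ≥ b / n` a multiple of `n ^ (1 - tr A)`. The amplitude `exp (-n R)` has
bounded total variation along the orbits, uniformly in `n`, because `y exp (-y) ≤ 1`.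
-/

section OperatorExponential

variable {V : Type*} [NormedAddCommGroup V] [NormedSpace ℝ V] [FiniteDimensional ℝ V]

lemma exp_add_smul (A : V →L[ℝ] V) (s t : ℝ) :
    NormedSpace.exp ((s + t) • A) = NormedSpace.exp (s • A) * NormedSpace.exp (t • A) := by
  let : NormedAlgebra ℚ (V →L[ℝ] V) := NormedAlgebra.restrictScalars ℚ ℝ (V →L[ℝ] V)
  have : CompleteSpace V := FiniteDimensional.complete ℝ V
  rw [add_smul, NormedSpace.exp_add_of_commute (((Commute.refl A).smul_left _).smul_right _)]

lemma contDiff_exp_smul_apply (A : V →L[ℝ] V) {n : WithTop ℕ∞} :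
    ContDiff ℝ n fun p : ℝ × V => NormedSpace.exp (p.1 • A) p.2 := by
  have : CompleteSpace V := FiniteDimensional.complete ℝ V
  have hexp : ContDiff ℝ n (NormedSpace.exp : (V →L[ℝ] V) → V →L[ℝ] V) :=
    AnalyticOnNhd.contDiff fun B _ => NormedSpace.exp_analytic B
  exact (hexp.comp (contDiff_fst.smul contDiff_const)).clm_apply contDiff_snd

lemma hasDerivAt_exp_smul_apply (A : V →L[ℝ] V) (s : ℝ) (x : V) :
    HasDerivAt (fun s : ℝ => NormedSpace.exp (s • A) x) (A (NormedSpace.exp (s • A) x)) s := by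
  have : CompleteSpace V := FiniteDimensional.complete ℝ V
  simpa using (hasDerivAt_exp_smul_const' (𝕂 := ℝ) A s).clm_apply (hasDerivAt_const s x)

lemma differentiable_det : Differentiable ℝ fun B : V →L[ℝ] V => B.det := by
  let b := Module.finBasis ℝ V
  have hcoord (i j) : Differentiable ℝ fun B : V →L[ℝ] V => LinearMap.toMatrix b b B i j := by
    simp only [LinearMap.toMatrix_apply]
    exact (LinearMap.toContinuousLinearMap (b.coord i)).differentiable.comp
      (ContinuousLinearMap.apply ℝ V (b j)).differentiable
  simp only [ContinuousLinearMap.det, ← LinearMap.det_toMatrix b, Matrix.det_apply]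
  fun_prop

lemma hasDerivAt_det_one_add_smul (A : V →L[ℝ] V) :
    HasDerivAt (fun h : ℝ => (1 + h • A).det) (LinearMap.trace ℝ V A) 0 := by
  let b := Module.finBasis ℝ V
  set M := LinearMap.toMatrix b b A
  have hpoly := (Matrix.det (1 + (Polynomial.X : Polynomial ℝ) • M.map Polynomial.C)).hasDerivAt 0
  rw [Matrix.derivative_det_one_add_X_smul] at hpoly
  rw [LinearMap.trace_eq_matrix_trace ℝ b]
  refine hpoly.congr_of_eventuallyEq (Eventually.of_forall fun h => ?_)
  have hM : LinearMap.toMatrix b b ((1 + h • A : V →L[ℝ] V) : V →ₗ[ℝ] V) = 1 + h • M := by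
    simp [M, LinearMap.toMatrix_one]
  simp only [ContinuousLinearMap.det]
  rw [← LinearMap.det_toMatrix b, hM, ← Polynomial.coe_evalRingHom, RingHom.map_det]
  congr 1
  ext i j
  rcases eq_or_ne i j with rfl | hij <;> simp [*, mul_comm h]

lemma hasDerivAt_det_exp_smul_zero (A : V →L[ℝ] V) :
    HasDerivAt (fun h : ℝ => (NormedSpace.exp (h • A)).det) (LinearMap.trace ℝ V A) 0 := by
  have : CompleteSpace V := FiniteDimensional.complete ℝ V
  have hdet := (differentiable_det (1 : V →L[ℝ] V)).hasFDerivAt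
  have hline : HasDerivAt (fun h : ℝ => 1 + h • A) A 0 := by
    simpa using ((hasDerivAt_id (0 : ℝ)).smul_const A).const_add 1
  have hexp : HasDerivAt (fun h : ℝ => NormedSpace.exp (h • A)) A 0 := by
    simpa using hasDerivAt_exp_smul_const (𝕂 := ℝ) A (0 : ℝ)
  have hdet_line := HasFDerivAt.comp_hasDerivAt_of_eq 0 hdet hline (by simp)
  rw [(hasDerivAt_det_one_add_smul A).unique hdet_line]
  exact HasFDerivAt.comp_hasDerivAt_of_eq 0 hdet hexp (by simp)

lemma hasDerivAt_det_exp_smul (A : V →L[ℝ] V) (s : ℝ) :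
    HasDerivAt (fun s : ℝ => (NormedSpace.exp (s • A)).det)
      ((NormedSpace.exp (s • A)).det * LinearMap.trace ℝ V A) s := by
  have h := hasDerivAt_det_exp_smul_zero A
  rw [← sub_self s] at h
  refine ((h.comp_sub_const s s).const_mul (NormedSpace.exp (s • A)).det).congr_of_eventuallyEq
    (Eventually.of_forall fun t => ?_)
  have hmul : NormedSpace.exp (t • A) =
      NormedSpace.exp (s • A) * NormedSpace.exp ((t - s) • A) := by
    rw [← exp_add_smul, add_sub_cancel]
  simp only [hmul]
  exact LinearMap.det_comp _ _

lemma det_exp_smul (A : V →L[ℝ] V) (s : ℝ) :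
    (NormedSpace.exp (s • A)).det = Real.exp (s * LinearMap.trace ℝ V A) := by
  set τ := LinearMap.trace ℝ V A
  have hderiv (s : ℝ) : HasDerivAt
      (fun s : ℝ => (NormedSpace.exp (s • A)).det * Real.exp (-(s * τ))) 0 s := by
    have hexp : HasDerivAt (fun s : ℝ => Real.exp (-(s * τ)))
        (Real.exp (-(s * τ)) * (-(1 * τ))) s :=
      ((hasDerivAt_id s).mul_const τ).neg.exp
    convert! (hasDerivAt_det_exp_smul A s).mul hexp using 1
    ring
  have hconst := is_const_of_deriv_eq_zero (fun s => (hderiv s).differentiableAt)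
    (fun s => (hderiv s).deriv) s 0
  have hone : (1 : V →L[ℝ] V).det = 1 := LinearMap.det_id
  simp only [zero_smul, NormedSpace.exp_zero, hone, zero_mul, neg_zero, Real.exp_zero, mul_one,
    Real.exp_neg] at hconst
  rwa [mul_inv_eq_one₀ (Real.exp_pos _).ne'] at hconst

end OperatorExponential

section OneParameterGroup

variable {d : ℕ}

lemma opPow_one (A : End d) : opPow 1 A = 1 := by
  rw [opPow, Real.log_one]
  exact (congrArg NormedSpace.exp (zero_smul ℝ A)).trans NormedSpace.exp_zero

lemma opPow_mul_apply {r s : ℝ} (hr : 0 < r) (hs : 0 < s) (A : End d) (x : E d) :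
    opPow (r * s) A x = opPow r A (opPow s A x) := by
  rw [opPow, Real.log_mul hr.ne' hs.ne', exp_add_smul]; rfl

lemma opPow_inv_apply {r : ℝ} (hr : 0 < r) (A : End d) (x : E d) :
    opPow r⁻¹ A (opPow r A x) = x := by
  rw [← opPow_mul_apply (inv_pos.2 hr) hr, inv_mul_cancel₀ hr.ne', opPow_one]; rfl

lemma opPow_apply_inv {r : ℝ} (hr : 0 < r) (A : End d) (x : E d) :
    opPow r A (opPow r⁻¹ A x) = x := by
  simpa only [inv_inv] using opPow_inv_apply (inv_pos.2 hr) A x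

lemma opPow_rpow_inv_smul {t k : ℝ} (ht : 0 < t) (hk : k ≠ 0) (A : End d) :
    opPow (t ^ k) (k⁻¹ • A) = opPow t A := by
  rw [opPow, opPow, Real.log_rpow ht, smul_smul, mul_right_comm, mul_inv_cancel₀ hk, one_mul]

lemma measurable_opPow_apply (A : End d) :
    Measurable fun p : ℝ × E d => opPow p.1 A p.2 :=
  (contDiff_exp_smul_apply A (n := 0)).continuous.measurable.comp
    ((Real.measurable_log.comp measurable_fst).prodMk measurable_snd)

lemma contDiffOn_opPow_apply (A : End d) {n : WithTop ℕ∞} :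
    ContDiffOn ℝ n (fun p : ℝ × E d => opPow p.1 A p.2) (Ioi 0 ×ˢ univ) :=
  (contDiff_exp_smul_apply A).comp_contDiffOn
    ((contDiffOn_fst.log fun _ hp => (mem_Ioi.1 hp.1).ne').prodMk contDiffOn_snd)

lemma contDiffAt_opPow_apply {r : ℝ} (hr : 0 < r) (A : End d) (x : E d) {n : WithTop ℕ∞} :
    ContDiffAt ℝ n (fun s => opPow s A x) r :=
  ((contDiffOn_opPow_apply A).contDiffAt (x := (r, x))
    (prod_mem_nhds (Ioi_mem_nhds hr) univ_mem)).comp r (contDiffAt_id.prodMk contDiffAt_const)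

lemma hasDerivAt_opPow_apply {r : ℝ} (hr : 0 < r) (A : End d) (x : E d) :
    HasDerivAt (fun s => opPow s A x) (r⁻¹ • A (opPow r A x)) r :=
  (hasDerivAt_exp_smul_apply A (Real.log r) x).scomp r (Real.hasDerivAt_log hr.ne')

/-- `r ^ A` as a homeomorphism of `ℝ^d`, with inverse `r⁻¹ ^ A`. -/
noncomputable def opPowHomeomorph {r : ℝ} (hr : 0 < r) (A : End d) : E d ≃ₜ E d where
  toFun := opPow r A
  invFun := opPow r⁻¹ A
  left_inv := opPow_inv_apply hr A
  right_inv := opPow_apply_inv hr A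

lemma det_opPow {r : ℝ} (hr : 0 < r) (A : End d) : (opPow r A).det = r ^ tr A := by
  rw [Real.rpow_def_of_pos hr]
  exact det_exp_smul A (Real.log r)

lemma map_opPow_volume {r : ℝ} (hr : 0 < r) (A : End d) :
    Measure.map (opPow r A) (volume : Measure (E d)) =
      ENNReal.ofReal (r ^ (-tr A)) • volume := by
  have hpos := Real.rpow_pos_of_pos hr (tr A)
  have hdet : LinearMap.det (opPow r A : E d →ₗ[ℝ] E d) = r ^ tr A := det_opPow hr A
  have hmap := Measure.map_linearMap_addHaar_eq_smul_addHaar (volume : Measure (E d))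
    (f := (opPow r A : E d →ₗ[ℝ] E d)) (by rw [hdet]; exact hpos.ne')
  rwa [hdet, abs_of_pos (inv_pos.2 hpos), ← Real.rpow_neg hr.le] at hmap

lemma volume_preimage_opPow {r : ℝ} (hr : 0 < r) (A : End d) (s : Set (E d)) :
    volume (opPow r A ⁻¹' s) = ENNReal.ofReal (r ^ (-tr A)) * volume s := by
  refine ((opPowHomeomorph hr A).measurableEmbedding.map_apply volume s).symm.trans ?_
  exact congrArg (fun ν : Measure (E d) => ν s) (map_opPow_volume hr A)

lemma setIntegral_opPow {F : Type*} [NormedAddCommGroup F] [NormedSpace ℝ F] {r : ℝ}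
    (hr : 0 < r) (A : End d) (s : Set (E d)) (f : E d → F) :
    ∫ x in opPow r A ⁻¹' s, f (opPow r A x) = r ^ (-tr A) • ∫ x in s, f x := by
  have h := (opPowHomeomorph hr A).measurableEmbedding.setIntegral_map (μ := volume) f s
  refine h.symm.trans ?_
  change ∫ x in s, f x ∂(Measure.map (opPow r A) volume) = _
  rw [map_opPow_volume hr, Measure.restrict_smul, integral_smul_measure,
    ENNReal.toReal_ofReal (Real.rpow_nonneg hr.le _)]

lemma integrable_comp_opPow {F : Type*} [NormedAddCommGroup F] {r : ℝ} (hr : 0 < r) (A : End d)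
    {f : E d → F} (hf : Integrable f) : Integrable fun x => f (opPow r A x) := by
  refine (opPowHomeomorph hr A).measurableEmbedding.integrable_map_iff.1 ?_
  change Integrable f (Measure.map (opPow r A) volume)
  rw [map_opPow_volume hr]
  exact hf.smul_measure ENNReal.ofReal_ne_top

lemma IsContracting.eventually_mem {A : End d} (hA : IsContracting A) {K : Set (E d)}
    (hK : IsCompact K) {U : Set (E d)} (hU : U ∈ 𝓝 (0 : E d)) :
    ∀ᶠ r in 𝓝[>] (0 : ℝ), ∀ x ∈ K, opPow r A x ∈ U := by
  obtain ⟨ε, hε, hεU⟩ := Metric.mem_nhds_iff.1 hU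
  obtain ⟨M, hM, hMK⟩ := hK.isBounded.exists_pos_norm_le
  filter_upwards [hA.eventually_lt_const (div_pos hε hM)] with r hr x hx
  refine hεU (mem_ball_zero_iff.2 ?_)
  calc ‖opPow r A x‖ ≤ ‖opPow r A‖ * M := (opPow r A).le_of_opNorm_le_of_le le_rfl (hMK x hx)
    _ < ε := (lt_div_iff₀ hM).1 hr

lemma IsContracting.exists_norm_opPow_eq_one {A : End d} (hA : IsContracting A) {x : E d}
    (hx : 1 ≤ ‖x‖) : ∃ r ∈ Ioc (0 : ℝ) 1, ‖opPow r A x‖ = 1 := by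
  have hball := hA.eventually_mem (isCompact_singleton (x := x)) (Metric.ball_mem_nhds 0 one_pos)
  obtain ⟨r₀, hr₀, hr₀pos, hr₀1⟩ := (hball.and (Ioc_mem_nhdsGT one_pos)).exists
  have hcont : ContinuousOn (fun r => ‖opPow r A x‖) (Icc r₀ 1) := fun r hr =>
    ((contDiffAt_opPow_apply (hr₀pos.trans_le hr.1) A x (n := 0)).continuousAt.norm
      ).continuousWithinAt
  have hmem : (1 : ℝ) ∈ Icc ‖opPow r₀ A x‖ ‖opPow 1 A x‖ :=
    ⟨(mem_ball_zero_iff.1 (hr₀ x rfl)).le, by simpa only [opPow_one]⟩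
  obtain ⟨r, hr, hr1⟩ := intermediate_value_Icc hr₀1 hcont hmem
  exact ⟨r, ⟨hr₀pos.trans_le hr.1, hr.2⟩, hr1⟩

end OneParameterGroup

section PositiveHomogeneous

variable {d : ℕ} {P : E d → ℝ} {A : End d}

lemma IsPosDef.pos (hP : IsPosDef P) {x : E d} (hx : x ≠ 0) : 0 < P x :=
  (hP.1 x).lt_of_ne' fun h => hx (hP.2 x h)

lemma IsHomogeneousWrt.apply_opPow (hA : IsHomogeneousWrt P A) {r : ℝ} (hr : 0 < r) (x : E d) :
    P (opPow r A x) = r * P x :=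
  (hA r hr x).symm

lemma IsHomogeneousWrt.map_zero (hA : IsHomogeneousWrt P A) : P 0 = 0 := by
  have := hA.apply_opPow two_pos 0
  rw [_root_.map_zero] at this
  linarith

lemma IsHomogeneousWrt.volume_sublevel (hA : IsHomogeneousWrt P A) {t : ℝ} (ht : 0 < t) :
    volume {x | P x ≤ t} = ENNReal.ofReal (t ^ tr A) * volume {x | P x ≤ 1} := by
  have h := volume_preimage_opPow (inv_pos.2 ht) A {x | P x ≤ 1}
  rw [Real.inv_rpow ht.le, ← Real.rpow_neg ht.le, neg_neg] at h
  rw [← h]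
  congr 1
  ext x
  simp only [mem_ofPred_eq, mem_preimage]
  rw [hA.apply_opPow (inv_pos.2 ht), inv_mul_le_iff₀ ht, mul_one]

/-- A point `x` outside the unit ball is `r⁻¹ ^ A z` with `‖z‖ = 1` and `r ≤ 1`; since
`r P x = P z ≥ min P > 0` on the sphere, `P x ≤ t` confines `r⁻¹` to a bounded interval. -/
lemma IsPositiveHomogeneous.isCompact_sublevel (hP : IsPositiveHomogeneous P) (t : ℝ) :
    IsCompact {x | P x ≤ t} := by
  obtain ⟨A, hA⟩ := hP.nonempty
  let S := Metric.sphere (0 : E d) 1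
  have hS : IsCompact S := isCompact_sphere 0 1
  obtain ⟨m, hm, hmin⟩ := hS.exists_forall_le' hP.continuous.continuousOn (a := 0) fun x hx =>
    hP.posDef.pos (ne_zero_of_mem_unit_sphere ⟨x, hx⟩)
  have hK : IsCompact (Metric.closedBall (0 : E d) 1 ∪
      (fun p : ℝ × E d => opPow p.1 A p.2) '' (Icc 1 (t / m) ×ˢ S)) :=
    (isCompact_closedBall _ _).union ((isCompact_Icc.prod hS).image_of_continuousOn
      ((contDiffOn_opPow_apply A (n := 0)).continuousOn.mono
        (prod_mono (fun r hr => one_pos.trans_le hr.1) (subset_univ _))))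
  refine hK.of_isClosed_subset (isClosed_le hP.continuous continuous_const) fun x hx => ?_
  rcases le_total ‖x‖ 1 with hx1 | hx1
  · exact Or.inl (mem_closedBall_zero_iff.2 hx1)
  obtain ⟨r, ⟨hr, hr1⟩, hrx⟩ := (hP.contracting A hA).exists_norm_opPow_eq_one hx1
  have hbound : m ≤ r * t := calc
    m ≤ P (opPow r A x) := hmin _ (mem_sphere_zero_iff_norm.2 hrx)
    _ = r * P x := IsHomogeneousWrt.apply_opPow hA hr x
    _ ≤ r * t := by gcongr; exact hx
  refine Or.inr ⟨(r⁻¹, opPow r A x), ⟨⟨(one_le_inv₀ hr).2 hr1, ?_⟩,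
    mem_sphere_zero_iff_norm.2 hrx⟩, opPow_inv_apply hr A x⟩
  rwa [le_div_iff₀ hm, inv_mul_le_iff₀ hr]

lemma IsPositiveHomogeneous.exists_opPow_apply_eq (hP : IsPositiveHomogeneous P)
    (hA : A ∈ expSet P) {x : E d} (hx : x ≠ 0) : ∃ y, P y = 1 ∧ opPow (P x) A y = x := by
  have h := hP.posDef.pos hx
  refine ⟨opPow (P x)⁻¹ A x, ?_, opPow_apply_inv h A x⟩
  rw [IsHomogeneousWrt.apply_opPow hA (inv_pos.2 h), inv_mul_cancel₀ h.ne']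

lemma IsPositiveHomogeneous.eventually_mem_of_lt (hP : IsPositiveHomogeneous P)
    {U : Set (E d)} (hU : U ∈ 𝓝 (0 : E d)) : ∀ᶠ b in 𝓝[>] (0 : ℝ), ∀ x, P x < b → x ∈ U := by
  obtain ⟨A, hA⟩ := hP.nonempty
  obtain ⟨δ, hδ, h⟩ := mem_nhdsGT_iff_exists_Ioo_subset.1
    ((hP.contracting A hA).eventually_mem (hP.isCompact_sublevel 1) hU)
  filter_upwards [Ioo_mem_nhdsGT hδ] with b hb x hx
  rcases eq_or_ne x 0 with rfl | hx0
  · exact mem_of_mem_nhds hU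
  obtain ⟨y, hy, hyx⟩ := hP.exists_opPow_apply_eq hA hx0
  exact hyx ▸ h ⟨hP.posDef.pos hx0, hx.trans hb.2⟩ y hy.le

end PositiveHomogeneous

section ExponentialIntegrals

variable {d : ℕ} {P : E d → ℝ} {A : End d}

lemma summable_exp_neg_mul_rpow (τ : ℝ) :
    Summable fun k : ℕ => Real.exp (-(k : ℝ)) * ((k : ℝ) + 1) ^ τ := by
  obtain ⟨N, hN⟩ := exists_nat_ge τ
  have h := (summable_nat_add_iff 1).2 (Real.summable_pow_mul_exp_neg_nat_mul N one_pos)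
  refine (h.mul_left (Real.exp 1)).of_nonneg_of_le (fun k => by positivity) fun k => ?_
  have hrpow : ((k : ℝ) + 1) ^ τ ≤ ((k : ℝ) + 1) ^ N := by
    rw [← Real.rpow_natCast]
    exact Real.rpow_le_rpow_of_exponent_le (le_add_of_nonneg_left k.cast_nonneg) hN
  calc Real.exp (-(k : ℝ)) * ((k : ℝ) + 1) ^ τ
      ≤ Real.exp (-(k : ℝ)) * ((k : ℝ) + 1) ^ N := by gcongr
    _ = Real.exp 1 * Real.exp (-1 * ((k + 1 : ℕ) : ℝ)) * ((k : ℝ) + 1) ^ N := by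
        rw [← Real.exp_add]; push_cast; ring_nf
    _ = Real.exp 1 * (((k + 1 : ℕ) : ℝ) ^ N * Real.exp (-1 * ((k + 1 : ℕ) : ℝ))) := by
        push_cast; ring

lemma IsPositiveHomogeneous.integrable_exp_neg (hP : IsPositiveHomogeneous P) :
    Integrable fun x => Real.exp (-P x) := by
  obtain ⟨A, hA⟩ := hP.nonempty
  refine ⟨(hP.continuous.neg.rexp).aestronglyMeasurable, ?_⟩
  rw [hasFiniteIntegral_iff_ofReal (Eventually.of_forall fun x => (Real.exp_pos _).le)]
  have hmeas (k : ℕ) : MeasurableSet {x | P x ≤ (k : ℝ) + 1} :=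
    (isClosed_le hP.continuous continuous_const).measurableSet
  calc ∫⁻ x, ENNReal.ofReal (Real.exp (-P x))
      ≤ ∫⁻ x, ∑' k : ℕ, {x | P x ≤ (k : ℝ) + 1}.indicator
          (fun _ => ENNReal.ofReal (Real.exp (-(k : ℝ)))) x := by
        refine lintegral_mono fun x => le_trans ?_ (ENNReal.le_tsum ⌊P x⌋₊)
        have hx : x ∈ {y | P y ≤ (⌊P x⌋₊ : ℝ) + 1} := (Nat.lt_floor_add_one (P x)).le
        rw [indicator_of_mem hx]
        gcongr
        exact Nat.floor_le (hP.posDef.1 x)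
    _ = ∑' k : ℕ, ENNReal.ofReal (Real.exp (-(k : ℝ))) * volume {x | P x ≤ (k : ℝ) + 1} := by
        rw [lintegral_tsum fun k => (measurable_const.indicator (hmeas k)).aemeasurable]
        simp only [lintegral_indicator_const (hmeas _)]
    _ = (∑' k : ℕ, ENNReal.ofReal (Real.exp (-(k : ℝ)) * ((k : ℝ) + 1) ^ tr A)) *
          volume {x | P x ≤ 1} := by
        rw [← ENNReal.tsum_mul_right]
        congr 1 with k
        rw [IsHomogeneousWrt.volume_sublevel hA (by positivity),
          ENNReal.ofReal_mul (Real.exp_pos _).le, mul_assoc]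
    _ < ⊤ := ENNReal.mul_lt_top (summable_exp_neg_mul_rpow _).tsum_ofReal_lt_top
        (hP.isCompact_sublevel 1).measure_lt_top

lemma IsPositiveHomogeneous.integrable_exp_neg_mul (hP : IsPositiveHomogeneous P) {l : ℝ}
    (hl : 0 < l) : Integrable fun x => Real.exp (-(l * P x)) := by
  obtain ⟨A, hA⟩ := hP.nonempty
  simp only [← IsHomogeneousWrt.apply_opPow hA hl]
  exact integrable_comp_opPow hl A hP.integrable_exp_neg

lemma IsHomogeneousWrt.integral_exp_neg_mul (hA : IsHomogeneousWrt P A) {l : ℝ} (hl : 0 < l) :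
    ∫ x, Real.exp (-(l * P x)) = l ^ (-tr A) * ∫ x, Real.exp (-P x) := by
  simpa only [preimage_univ, Measure.restrict_univ, smul_eq_mul, hA.apply_opPow hl]
    using setIntegral_opPow hl A univ fun x => Real.exp (-P x)

end ExponentialIntegrals

section Annulus

/-- The half-open shell `{a ≤ P < b}`. The shell `{1 ≤ P < 2}` replaces the unit sphere `{P = 1}`
in the polar decomposition below, which then needs no surface measure. -/
def annulus {X : Type*} (P : X → ℝ) (a b : ℝ) : Set X := P ⁻¹' Ico a b

section Kernel

variable {X F : Type*} {P : X → ℝ} [NormedAddCommGroup F] [NormedSpace ℝ F]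

lemma integrableOn_inv_Ioc_half {c : ℝ} (hc : 0 < c) :
    IntegrableOn (fun t : ℝ => t⁻¹) (Ioc (c / 2) c) := by
  refine (ContinuousOn.integrableOn_Icc fun t ht => ?_).mono_set Ioc_subset_Icc_self
  exact (continuousAt_inv₀ ((half_pos hc).trans_le ht.1).ne').continuousWithinAt

lemma setIntegral_inv_Ioc_half {c : ℝ} (hc : 0 < c) :
    ∫ t in Ioc (c / 2) c, t⁻¹ = Real.log 2 := by
  rw [← intervalIntegral.integral_of_le (half_le_self hc.le), integral_inv_of_pos (half_pos hc) hc,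
    div_div_cancel₀ hc.ne']

lemma mem_annulus_two_mul_iff {x : X} {t : ℝ} :
    x ∈ annulus P t (2 * t) ↔ t ∈ Ioc (P x / 2) (P x) := by
  rw [annulus, mem_preimage, mem_Ico, mem_Ioc, div_lt_iff₀' two_pos, and_comm]

lemma setIntegral_Ioi_indicator_Ioc_half [CompleteSpace F] {c : ℝ} (hc : 0 < c) (v : F) :
    ∫ t in Ioi 0, (Ioc (c / 2) c).indicator (fun t => t⁻¹ • v) t = Real.log 2 • v := by
  have hsub : Ioc (c / 2) c ⊆ Ioi 0 := fun t ht => (half_pos hc).trans ht.1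
  rw [setIntegral_indicator measurableSet_Ioc, inter_eq_self_of_subset_right hsub,
    integral_smul_const, setIntegral_inv_Ioc_half hc]

variable [MeasurableSpace X] {μ : Measure X} {g : X → F}

lemma integral_indicator_annulus (hP : Measurable P) (t : ℝ) :
    ∫ x, (Ioc (P x / 2) (P x)).indicator (fun t => t⁻¹ • g x) t ∂μ =
      t⁻¹ • ∫ x in annulus P t (2 * t), g x ∂μ := by
  rw [← integral_smul, ← integral_indicator (s := annulus P t (2 * t)) (hP measurableSet_Ico)]
  congr 1 with x
  simp only [indicator, mem_annulus_two_mul_iff]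

variable [SFinite μ]

lemma integrable_indicator_annulus (hP : Measurable P) (hg : Integrable g μ)
    (hgm : StronglyMeasurable g) (hg0 : ∀ x, P x ≤ 0 → g x = 0) :
    Integrable (fun p : ℝ × X => (Ioc (P p.2 / 2) (P p.2)).indicator (fun t => t⁻¹ • g p.2) p.1)
      ((volume.restrict (Ioi 0)).prod μ) := by
  have hset : MeasurableSet {p : ℝ × X | p.1 ∈ Ioc (P p.2 / 2) (P p.2)} :=
    (measurableSet_lt ((hP.comp measurable_snd).div_const 2) measurable_fst).inter
      (measurableSet_le measurable_fst (hP.comp measurable_snd))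
  have hmeas : StronglyMeasurable fun p : ℝ × X =>
      (Ioc (P p.2 / 2) (P p.2)).indicator (fun t => t⁻¹ • g p.2) p.1 :=
    (measurable_fst.inv.stronglyMeasurable.smul (hgm.comp_measurable measurable_snd)).indicator hset
  have hpos (x : X) : g x = 0 ∨ 0 < P x := (le_or_gt (P x) 0).imp_left (hg0 x)
  refine (integrable_prod_iff' hmeas.aestronglyMeasurable).2
    ⟨Eventually.of_forall fun x => ?_, (hg.norm.const_mul (Real.log 2)).congr
      (Eventually.of_forall fun x => ?_)⟩
  · rcases hpos x with hx | hx
    · simp only [hx, smul_zero, indicator_zero]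
      exact integrable_zero ℝ F _
    · exact (((integrable_indicator_iff measurableSet_Ioc).2
        ((integrableOn_inv_Ioc_half hx).smul_const (g x)))).restrict
  · rcases hpos x with hx | hx
    · simp only [hx, norm_zero, smul_zero, indicator_zero, integral_zero, mul_zero]
    · simp only
      rw [← smul_eq_mul, ← setIntegral_Ioi_indicator_Ioc_half hx]
      refine setIntegral_congr_fun measurableSet_Ioi fun t ht => ?_
      rw [norm_indicator_eq_indicator_norm]
      simp only [indicator, norm_smul, norm_inv, Real.norm_of_nonneg (mem_Ioi.1 ht).le,
        smul_eq_mul]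

lemma integrableOn_integral_annulus (hP : Measurable P) (hg : Integrable g μ)
    (hgm : StronglyMeasurable g) (hg0 : ∀ x, P x ≤ 0 → g x = 0) :
    IntegrableOn (fun t : ℝ => t⁻¹ • ∫ x in annulus P t (2 * t), g x ∂μ) (Ioi 0) := by
  simpa only [IntegrableOn, integral_indicator_annulus hP]
    using (integrable_indicator_annulus hP hg hgm hg0).integral_prod_left

lemma setIntegral_Ioi_integral_annulus [CompleteSpace F] (hP : Measurable P)
    (hg : Integrable g μ) (hgm : StronglyMeasurable g) (hg0 : ∀ x, P x ≤ 0 → g x = 0) :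
    ∫ t in Ioi 0, t⁻¹ • ∫ x in annulus P t (2 * t), g x ∂μ = Real.log 2 • ∫ x, g x ∂μ := by
  simp only [← integral_indicator_annulus hP]
  rw [integral_integral_swap (integrable_indicator_annulus hP hg hgm hg0), ← integral_smul]
  congr 1 with x
  rcases le_or_gt (P x) 0 with hx | hx
  · simp only [hg0 x hx, smul_zero, indicator_zero, integral_zero]
  · exact setIntegral_Ioi_indicator_Ioc_half hx (g x)

end Kernel

variable {d : ℕ} {P : E d → ℝ} {A : End d}

lemma IsPositiveHomogeneous.measure_annulus_lt_top (hP : IsPositiveHomogeneous P) (a b : ℝ) :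
    volume (annulus P a b) < ⊤ :=
  (measure_mono fun _ hx => hx.2.le).trans_lt (hP.isCompact_sublevel b).measure_lt_top

lemma IsHomogeneousWrt.mem_annulus_opPow_iff (hA : IsHomogeneousWrt P A) {t : ℝ} (ht : 0 < t)
    {y : E d} (hy : 0 < P y) {a b : ℝ} :
    opPow t A y ∈ annulus P a b ↔ t ∈ Ico (a / P y) (b / P y) := by
  rw [annulus, mem_preimage, hA.apply_opPow ht, mem_Ico, mem_Ico, div_le_iff₀ hy, lt_div_iff₀ hy]

variable {F : Type*} [NormedAddCommGroup F] [NormedSpace ℝ F] {g : E d → F}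

lemma IsHomogeneousWrt.setIntegral_annulus_opPow (hA : IsHomogeneousWrt P A) {t : ℝ}
    (ht : 0 < t) (g : E d → F) :
    ∫ y in annulus P 1 2, t ^ (tr A - 1) • g (opPow t A y) =
      t⁻¹ • ∫ x in annulus P t (2 * t), g x := by
  have hpre : annulus P 1 2 = opPow t A ⁻¹' annulus P t (2 * t) := by
    ext y
    simp only [annulus, mem_preimage, hA.apply_opPow ht, mem_Ico, mul_comm 2 t]
    rw [le_mul_iff_one_le_right ht, mul_lt_mul_iff_right₀ ht]
  rw [integral_smul, hpre, setIntegral_opPow ht, smul_smul, ← Real.rpow_add ht,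
    ← Real.rpow_neg_one]
  congr 2
  ring

lemma IsHomogeneousWrt.integrable_rpow_smul_opPow (hA : IsHomogeneousWrt P A)
    (hP : Measurable P) (hg : Integrable g) (hgm : StronglyMeasurable g)
    (hg0 : ∀ x, P x ≤ 0 → g x = 0) :
    Integrable (fun p : E d × ℝ => p.2 ^ (tr A - 1) • g (opPow p.2 A p.1))
      ((volume.restrict (annulus P 1 2)).prod (volume.restrict (Ioi 0))) := by
  have hmeas : StronglyMeasurable fun p : E d × ℝ => p.2 ^ (tr A - 1) • g (opPow p.2 A p.1) :=
    (measurable_snd.pow_const _).stronglyMeasurable.smul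
      (hgm.comp_measurable ((measurable_opPow_apply A).comp measurable_swap))
  refine (integrable_prod_iff' hmeas.aestronglyMeasurable).2 ⟨?_, ?_⟩
  · refine (ae_restrict_mem measurableSet_Ioi).mono fun t ht => ?_
    exact Integrable.smul (t ^ (tr A - 1)) (integrable_comp_opPow ht A hg).restrict
  · refine (integrableOn_integral_annulus hP hg.norm hgm.norm
      fun x hx => norm_eq_zero.2 (hg0 x hx)).congr_fun (fun t ht => ?_) measurableSet_Ioi
    simp only [norm_smul, Real.norm_of_nonneg (Real.rpow_nonneg (mem_Ioi.1 ht).le _)]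
    exact (hA.setIntegral_annulus_opPow ht fun x => ‖g x‖).symm

lemma IsHomogeneousWrt.setIntegral_annulus_setIntegral_Ioi [CompleteSpace F]
    (hA : IsHomogeneousWrt P A) (hP : Measurable P) (hg : Integrable g)
    (hgm : StronglyMeasurable g) (hg0 : ∀ x, P x ≤ 0 → g x = 0) :
    ∫ y in annulus P 1 2, ∫ t in Ioi 0, t ^ (tr A - 1) • g (opPow t A y) =
      Real.log 2 • ∫ x, g x := by
  rw [integral_integral_swap (hA.integrable_rpow_smul_opPow hP hg hgm hg0),
    ← setIntegral_Ioi_integral_annulus hP hg hgm hg0]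
  exact setIntegral_congr_fun measurableSet_Ioi fun t ht => hA.setIntegral_annulus_opPow ht g

lemma IsPositiveHomogeneous.norm_setIntegral_annulus_le [CompleteSpace F]
    (hP : IsPositiveHomogeneous P) (hA : A ∈ expSet P) {f : E d → F} (hf : Continuous f)
    {a b M : ℝ} (ha : 0 < a)
    (hM : ∀ y ∈ annulus P 1 2,
      ‖∫ t in Ico (a / P y) (b / P y), t ^ (tr A - 1) • f (opPow t A y)‖ ≤ M) :
    ‖∫ x in annulus P a b, f x‖ ≤ M * volume.real (annulus P 1 2) / Real.log 2 := by
  have hlog : 0 < Real.log 2 := Real.log_pos one_lt_two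
  have hmeas : MeasurableSet (annulus P a b) := hP.continuous.measurable measurableSet_Ico
  have hint : IntegrableOn f (annulus P a b) :=
    (hf.continuousOn.integrableOn_compact (hP.isCompact_sublevel b)).mono_set fun _ hx => hx.2.le
  have hpolar := IsHomogeneousWrt.setIntegral_annulus_setIntegral_Ioi hA hP.continuous.measurable
    (hint.integrable_indicator hmeas) (hf.stronglyMeasurable.indicator hmeas)
    fun x hx => indicator_of_notMem (fun h => absurd (ha.trans_le h.1) hx.not_gt) f
  rw [integral_indicator hmeas] at hpolar
  rw [le_div_iff₀ hlog, mul_comm, ← Real.norm_of_nonneg hlog.le, ← norm_smul, ← hpolar]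
  refine norm_setIntegral_le_of_norm_le_const (hP.measure_annulus_lt_top 1 2) fun y hy => ?_
  have hy0 : 0 < P y := one_pos.trans_le hy.1
  have horbit : ∫ t in Ioi 0, t ^ (tr A - 1) • (annulus P a b).indicator f (opPow t A y) =
      ∫ t in Ico (a / P y) (b / P y), t ^ (tr A - 1) • f (opPow t A y) := by
    have hsub : Ico (a / P y) (b / P y) ⊆ Ioi 0 := fun t ht => (div_pos ha hy0).trans_le ht.1
    conv_rhs => rw [← inter_eq_self_of_subset_right hsub, ← setIntegral_indicator measurableSet_Ico]
    refine setIntegral_congr_fun measurableSet_Ioi fun t ht => ?_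
    simp only [indicator, IsHomogeneousWrt.mem_annulus_opPow_iff hA ht hy0, smul_ite, smul_zero]
  rw [horbit]
  exact hM y hy

lemma IsPositiveHomogeneous.norm_setIntegral_sublevel_le [CompleteSpace F]
    (hP : IsPositiveHomogeneous P) (hA : A ∈ expSet P) {f : E d → F} (hf : Continuous f)
    {a b M : ℝ} (hf1 : ∀ ξ, P ξ < b → ‖f ξ‖ ≤ 1) (ha : 0 < a) (hab : a ≤ b)
    (hM : ∀ y ∈ annulus P 1 2,
      ‖∫ t in Ico (a / P y) (b / P y), t ^ (tr A - 1) • f (opPow t A y)‖ ≤ M) :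
    ‖∫ ξ in {ξ | P ξ < b}, f ξ‖ ≤ a ^ tr A * volume.real {ξ | P ξ ≤ 1} +
      M * volume.real (annulus P 1 2) / Real.log 2 := by
  have hsplit : {ξ | P ξ < b} = {ξ | P ξ < a} ∪ annulus P a b := by
    ext ξ
    exact ⟨fun h => (lt_or_ge (P ξ) a).imp id fun h' => ⟨h', h⟩,
      fun h => h.elim (fun h => lt_of_lt_of_le h hab) And.right⟩
  have hdisj : Disjoint {ξ | P ξ < a} (annulus P a b) :=
    disjoint_left.2 fun ξ h h' => not_lt.2 h'.1 h
  have hmeas : MeasurableSet (annulus P a b) := hP.continuous.measurable measurableSet_Ico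
  have hlt_le (c : ℝ) : {ξ | P ξ < c} ⊆ {ξ | P ξ ≤ c} := fun ξ (h : P ξ < c) => h.le
  have hint : IntegrableOn f {ξ | P ξ < b} :=
    (hf.continuousOn.integrableOn_compact (hP.isCompact_sublevel b)).mono_set (hlt_le b)
  rw [hsplit] at hint
  have hsmall : ‖∫ ξ in {ξ | P ξ < a}, f ξ‖ ≤ a ^ tr A * volume.real {ξ | P ξ ≤ 1} :=
    calc ‖∫ ξ in {ξ | P ξ < a}, f ξ‖
        ≤ 1 * volume.real {ξ | P ξ < a} :=
          norm_setIntegral_le_of_norm_le_const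
            ((measure_mono (hlt_le a)).trans_lt (hP.isCompact_sublevel a).measure_lt_top)
            fun ξ h => hf1 ξ (lt_of_lt_of_le h hab)
      _ ≤ volume.real {ξ | P ξ ≤ a} := by
          rw [one_mul]
          exact measureReal_mono (hlt_le a) (hP.isCompact_sublevel a).measure_lt_top.ne
      _ = a ^ tr A * volume.real {ξ | P ξ ≤ 1} := by
          rw [Measure.real, IsHomogeneousWrt.volume_sublevel hA ha, ENNReal.toReal_mul,
            ENNReal.toReal_ofReal (Real.rpow_nonneg ha.le _), Measure.real]
  rw [hsplit, setIntegral_union hdisj hmeas hint.left_of_union hint.right_of_union]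
  exact norm_add_le_of_le hsmall (hP.norm_setIntegral_annulus_le hA hf ha hM)

end Annulus

section VanDerCorput

lemma norm_integral_mul_deriv_le {a b : ℝ} (hab : a ≤ b) {u u' v v' : ℝ → ℂ} {w : ℝ → ℝ}
    (hu : ∀ t ∈ Icc a b, HasDerivAt u (u' t) t) (hu' : ContinuousOn u' (Icc a b))
    (hu1 : ∀ t ∈ Icc a b, ‖u t‖ ≤ 1) (hv : ∀ t ∈ Icc a b, HasDerivAt v (v' t) t)
    (hw : IntervalIntegrable w volume a b) (hvw : ∀ t ∈ Icc a b, ‖v' t‖ ≤ w t) :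
    ‖∫ t in a..b, v t * u' t‖ ≤ ‖v a‖ + ‖v b‖ + ∫ t in a..b, w t := by
  rw [← uIcc_of_le hab] at hu hu' hv
  have hv' : IntervalIntegrable v' volume a b := by
    refine hw.mono_fun' ((aestronglyMeasurable_deriv v _).congr ?_) ?_
    · filter_upwards [ae_restrict_mem measurableSet_uIoc] with t ht
      exact (hv t (uIoc_subset_uIcc ht)).deriv
    · filter_upwards [ae_restrict_mem measurableSet_uIoc] with t ht
      exact hvw t (uIcc_of_le hab ▸ uIoc_subset_uIcc ht)
  have hrest : ‖∫ t in a..b, v' t * u t‖ ≤ ∫ t in a..b, w t := by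
    refine intervalIntegral.norm_integral_le_of_norm_le hab (ae_of_all _ fun t ht => ?_) hw
    have htI := Ioc_subset_Icc_self ht
    rw [norm_mul]
    exact (mul_le_of_le_one_right (norm_nonneg _) (hu1 t htI)).trans (hvw t htI)
  have hend {t : ℝ} (ht : t ∈ Icc a b) : ‖v t * u t‖ ≤ ‖v t‖ := by
    rw [norm_mul]
    exact mul_le_of_le_one_right (norm_nonneg _) (hu1 t ht)
  rw [intervalIntegral.integral_mul_deriv_eq_deriv_mul hv hu hv' hu'.intervalIntegrable]
  linarith [norm_sub_le (v b * u b - v a * u a) (∫ t in a..b, v' t * u t),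
    norm_sub_le (v b * u b) (v a * u a), hend (left_mem_Icc.2 hab), hend (right_mem_Icc.2 hab)]

lemma hasDerivAt_cexp_I_mul {θ : ℝ → ℝ} {θ' t : ℝ} (hθ : HasDerivAt θ θ' t) :
    HasDerivAt (fun t => Complex.exp (Complex.I * θ t))
      (Complex.exp (Complex.I * θ t) * (Complex.I * θ')) t :=
  (hθ.ofReal_comp.const_mul Complex.I).cexp

lemma hasDerivAt_div_I_mul {g : ℝ → ℂ} {g' : ℂ} {ψ : ℝ → ℝ} {ψ' t : ℝ}
    (hg : HasDerivAt g g' t) (hψ : HasDerivAt ψ ψ' t) (h0 : ψ t ≠ 0) :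
    HasDerivAt (fun t => g t / (Complex.I * ψ t))
      ((g' - g t * (ψ' / ψ t : ℝ)) / (Complex.I * ψ t)) t := by
  have h0' : (ψ t : ℂ) ≠ 0 := Complex.ofReal_ne_zero.2 h0
  convert! hg.div (hψ.ofReal_comp.const_mul Complex.I) (mul_ne_zero Complex.I_ne_zero h0') using 1
  push_cast
  field_simp

lemma norm_sub_mul_div_le {g g' : ℂ} {ψ ψ' t s l M D : ℝ} (ht : 0 < t) (hl : 0 < l)
    (hψl : l ≤ |ψ|) (hψ' : |ψ'| ≤ M * |ψ| / t) (hg : ‖g‖ ≤ D * t ^ s)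
    (hg' : ‖g'‖ ≤ D * t ^ (s - 1)) :
    ‖(g' - g * (ψ' / ψ : ℝ)) / (Complex.I * ψ)‖ ≤ D / l * (1 + M) * t ^ (s - 1) := by
  have hψ : 0 < |ψ| := hl.trans_le hψl
  have hquot : |ψ' / ψ| ≤ M / t := by
    rw [abs_div, div_le_iff₀ hψ]
    exact hψ'.trans_eq (mul_div_right_comm _ _ _)
  have hnum : ‖g' - g * (ψ' / ψ : ℝ)‖ ≤ D * (1 + M) * t ^ (s - 1) := calc
    _ ≤ ‖g'‖ + ‖g‖ * |ψ' / ψ| := by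
      simpa only [norm_mul, Complex.norm_real, Real.norm_eq_abs] using
        norm_sub_le g' (g * (ψ' / ψ : ℝ))
    _ ≤ D * t ^ (s - 1) + D * t ^ s * (M / t) := by
      gcongr
      exact (norm_nonneg g).trans hg
    _ = D * (1 + M) * t ^ (s - 1) := by
      rw [Real.rpow_sub_one ht.ne']
      ring
  rw [norm_div, norm_mul, Complex.norm_I, one_mul, Complex.norm_real, Real.norm_eq_abs]
  calc _ ≤ D * (1 + M) * t ^ (s - 1) / l :=
        div_le_div₀ ((norm_nonneg _).trans hnum) hnum hl hψl
    _ = D / l * (1 + M) * t ^ (s - 1) := by ring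

lemma intervalIntegrable_rpow_of_pos {a b : ℝ} (ha : 0 < a) (hab : a ≤ b) (s : ℝ) :
    IntervalIntegrable (fun t : ℝ => t ^ s) volume a b :=
  intervalIntegral.intervalIntegrable_rpow (Or.inr (by
    rw [uIcc_of_le hab]
    exact fun h => ha.not_ge h.1))

lemma integral_rpow_sub_one_le {a b s : ℝ} (ha : 0 < a) (hab : a ≤ b) (hs : s < 0) :
    ∫ t in a..b, t ^ (s - 1) ≤ a ^ s / -s := by
  have h0 : (0 : ℝ) ∉ uIcc a b := by
    rw [uIcc_of_le hab]
    exact fun h => ha.not_ge h.1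
  rw [integral_rpow (Or.inr ⟨by linarith, h0⟩), sub_add_cancel, ← neg_div_neg_eq, neg_sub]
  exact div_le_div_of_nonneg_right (sub_le_self _ (Real.rpow_nonneg (ha.le.trans hab) s))
    (neg_pos.2 hs).le

/-- Van der Corput's first derivative estimate: `exp (i θ) g` is `(exp (i θ))' (g / (i θ'))`. -/
lemma norm_integral_cexp_I_mul_mul_le {a b s l M D : ℝ} (ha : 0 < a) (hab : a ≤ b) (hs : s < 0)
    (hl : 0 < l) {θ θ' θ'' : ℝ → ℝ} {g g' : ℝ → ℂ}
    (hθ : ∀ t ∈ Icc a b, HasDerivAt θ (θ' t) t) (hθ' : ∀ t ∈ Icc a b, HasDerivAt θ' (θ'' t) t)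
    (hg : ∀ t ∈ Icc a b, HasDerivAt g (g' t) t) (hθl : ∀ t ∈ Icc a b, l ≤ |θ' t|)
    (hθM : ∀ t ∈ Icc a b, |θ'' t| ≤ M * |θ' t| / t) (hgD : ∀ t ∈ Icc a b, ‖g t‖ ≤ D * t ^ s)
    (hgD' : ∀ t ∈ Icc a b, ‖g' t‖ ≤ D * t ^ (s - 1)) :
    ‖∫ t in a..b, Complex.exp (Complex.I * θ t) * g t‖ ≤
      D / l * (2 + (1 + M) / -s) * a ^ s := by
  have hpos {t : ℝ} (ht : t ∈ Icc a b) : 0 < t := ha.trans_le ht.1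
  have hne {t : ℝ} (ht : t ∈ Icc a b) : θ' t ≠ 0 := abs_pos.1 (hl.trans_le (hθl t ht))
  have haI := left_mem_Icc.2 hab
  have hD : 0 ≤ D := nonneg_of_mul_nonneg_left ((norm_nonneg _).trans (hgD a haI))
    (Real.rpow_pos_of_pos ha s)
  have hM : 0 ≤ M := by
    have h := (abs_nonneg _).trans (hθM a haI)
    rw [mul_div_assoc] at h
    exact nonneg_of_mul_nonneg_left h (div_pos (abs_pos.2 (hne haI)) ha)
  have hend {t : ℝ} (ht : t ∈ Icc a b) : ‖g t / (Complex.I * θ' t)‖ ≤ D / l * a ^ s := by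
    rw [norm_div, norm_mul, Complex.norm_I, one_mul, Complex.norm_real, Real.norm_eq_abs,
      div_mul_eq_mul_div]
    refine div_le_div₀ (by positivity) ((hgD t ht).trans ?_) hl (hθl t ht)
    exact mul_le_mul_of_nonneg_left (Real.rpow_le_rpow_of_nonpos ha ht.1 hs.le) hD
  have hparts := norm_integral_mul_deriv_le hab (fun t ht => hasDerivAt_cexp_I_mul (hθ t ht))
    (fun t ht => ((hasDerivAt_cexp_I_mul (hθ t ht)).continuousAt.mul
      (continuousAt_const.mul (hθ' t ht).ofReal_comp.continuousAt)).continuousWithinAt)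
    (fun t _ => (Complex.norm_exp_I_mul_ofReal (θ t)).le)
    (fun t ht => hasDerivAt_div_I_mul (hg t ht) (hθ' t ht) (hne ht))
    ((intervalIntegrable_rpow_of_pos ha hab (s - 1)).const_mul (D / l * (1 + M)))
    (fun t ht => norm_sub_mul_div_le (hpos ht) hl (hθl t ht) (hθM t ht) (hgD t ht) (hgD' t ht))
  have heq : ∫ t in a..b, Complex.exp (Complex.I * θ t) * g t =
      ∫ t in a..b, g t / (Complex.I * θ' t) *
        (Complex.exp (Complex.I * θ t) * (Complex.I * θ' t)) := by
    refine intervalIntegral.integral_congr fun t ht => ?_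
    rw [uIcc_of_le hab] at ht
    have hnz : Complex.I * θ' t ≠ 0 :=
      mul_ne_zero Complex.I_ne_zero (Complex.ofReal_ne_zero.2 (hne ht))
    rw [mul_left_comm (g t / _), div_mul_cancel₀ _ hnz]
  rw [heq]
  rw [intervalIntegral.integral_const_mul] at hparts
  calc _ ≤ D / l * a ^ s + D / l * a ^ s + D / l * (1 + M) * (a ^ s / -s) :=
        hparts.trans (add_le_add (add_le_add (hend haI) (hend (right_mem_Icc.2 hab)))
          (mul_le_mul_of_nonneg_left (integral_rpow_sub_one_le ha hab hs) (by positivity)))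
    _ = D / l * (2 + (1 + M) / -s) * a ^ s := by ring

end VanDerCorput

section Subhomogeneous

variable {d : ℕ} {P f : E d → ℝ} {A : End d} {U K : Set (E d)} {l : ℕ} {ε : ℝ}

lemma IsContracting.tendsto_opPow_apply (hA : IsContracting A) (x : E d) :
    Tendsto (fun r => opPow r A x) (𝓝[>] 0) (𝓝 0) := fun _ hU =>
  (hA.eventually_mem isCompact_singleton hU).mono fun _ hr => hr x rfl

lemma IsSubhomogeneous.eventually_abs_le (h : IsSubhomogeneous U f A) (hε : 0 < ε)
    (hK : IsCompact K) : ∀ᶠ r in 𝓝[>] (0 : ℝ), ∀ x ∈ K, |f (opPow r A x)| ≤ ε * r := by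
  obtain ⟨δ, hδ, h⟩ := h.2 ε hε K hK
  filter_upwards [Ioo_mem_nhdsGT hδ] with r hr using h r hr.1 hr.2

lemma IsStronglySubhomogeneous.eventually_abs_iteratedDeriv_le
    (h : IsStronglySubhomogeneous l U f A) {j : ℕ} (hj : j + 1 ≤ l) (hε : 0 < ε)
    (hK : IsCompact K) : ∀ᶠ r in 𝓝[>] (0 : ℝ), ∀ x ∈ K,
      |iteratedDeriv (j + 1) (fun s => f (opPow s A x)) r| ≤ ε / r ^ j := by
  obtain ⟨δ, hδ, h⟩ := h.2 ε hε K hK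
  filter_upwards [Ioo_mem_nhdsGT hδ] with r hr x hx
  have hle := h (j + 1) j.succ_pos hj r hr.1 hr.2 x hx
  rw [abs_mul, abs_of_pos (pow_pos hr.1 _), pow_succ, mul_right_comm] at hle
  rw [le_div_iff₀' (pow_pos hr.1 j)]
  exact le_of_mul_le_mul_right hle hr.1

lemma IsStronglySubhomogeneous.eventually_abs_deriv_le
    (h : IsStronglySubhomogeneous l U f A) (hl : 1 ≤ l) (hε : 0 < ε) (hK : IsCompact K) :
    ∀ᶠ r in 𝓝[>] (0 : ℝ), ∀ x ∈ K, |deriv (fun s => f (opPow s A x)) r| ≤ ε := by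
  simpa only [zero_add, iteratedDeriv_one, pow_zero, div_one]
    using h.eventually_abs_iteratedDeriv_le hl hε hK

lemma contDiffAt_comp_opPow {n : WithTop ℕ∞} (hf : ContDiffOn ℝ n f U) (hU : IsOpen U) {r : ℝ}
    (hr : 0 < r) {x : E d} (hx : opPow r A x ∈ U) :
    ContDiffAt ℝ n (fun s => f (opPow s A x)) r :=
  (hf.contDiffAt (hU.mem_nhds hx)).comp r (contDiffAt_opPow_apply hr A x)

lemma abs_le_mul_of_abs_deriv_le {F : ℝ → ℝ} {r : ℝ} (hr : 0 < r)
    (hF : ∀ s ∈ Ioc 0 r, DifferentiableAt ℝ F s) (hF' : ∀ s ∈ Ioc 0 r, |deriv F s| ≤ ε)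
    (hF0 : Tendsto F (𝓝[>] 0) (𝓝 0)) : |F r| ≤ ε * r := by
  have hlim : Tendsto (fun s => ε * (r - s)) (𝓝[>] 0) (𝓝 (ε * (r - 0))) :=
    (tendsto_nhdsWithin_of_tendsto_nhds tendsto_id).const_sub r |>.const_mul ε
  have hlimF : Tendsto (fun s => |F r - F s|) (𝓝[>] 0) (𝓝 |F r - 0|) :=
    (hF0.const_sub (F r)).abs
  rw [sub_zero] at hlim hlimF
  refine le_of_tendsto_of_tendsto hlimF hlim ?_
  filter_upwards [Ioo_mem_nhdsGT hr] with s hs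
  have hmv := (convex_Ioc 0 r).norm_image_sub_le_of_norm_deriv_le hF hF' ⟨hs.1, hs.2.le⟩
    (right_mem_Ioc.2 hr)
  rwa [Real.norm_of_nonneg (sub_nonneg.2 hs.2.le)] at hmv

lemma IsStronglySubhomogeneous.isSubhomogeneous (h : IsStronglySubhomogeneous l U f A)
    (hl : 1 ≤ l) (hA : IsContracting A) (hU : IsOpen U) (h0 : (0 : E d) ∈ U) (hf0 : f 0 = 0) :
    IsSubhomogeneous U f A := by
  refine ⟨h.1.continuousOn, fun ε hε K hK => ?_⟩
  obtain ⟨δ, hδ, hδK⟩ := mem_nhdsGT_iff_exists_Ioo_subset.1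
    ((h.eventually_abs_deriv_le hl hε hK).and (hA.eventually_mem hK (hU.mem_nhds h0)))
  refine ⟨δ, hδ, fun r hr hrδ x hx => ?_⟩
  have hIoo {s : ℝ} (hs : s ∈ Ioc 0 r) : s ∈ Ioo 0 δ := ⟨hs.1, hs.2.trans_lt hrδ⟩
  have hf : Tendsto f (𝓝 0) (𝓝 0) := by
    simpa only [ContinuousAt, hf0] using h.1.continuousOn.continuousAt (hU.mem_nhds h0)
  exact abs_le_mul_of_abs_deriv_le hr
    (fun s hs => (contDiffAt_comp_opPow h.1 hU hs.1 ((hδK (hIoo hs)).2 x hx)).differentiableAt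
      (by exact_mod_cast Nat.one_le_iff_ne_zero.1 hl))
    (fun s hs => (hδK (hIoo hs)).1 x hx) (hf.comp (hA.tendsto_opPow_apply x))

lemma IsPositiveHomogeneous.eventually_abs_le_mul (hP : IsPositiveHomogeneous P)
    (hA : A ∈ expSet P) (hf : IsSubhomogeneous U f A) (hf0 : f 0 = 0) (hε : 0 < ε) :
    ∀ᶠ x in 𝓝 0, |f x| ≤ ε * P x := by
  have hP0 : P 0 = 0 := IsHomogeneousWrt.map_zero hA
  obtain ⟨δ, hδ, h⟩ := mem_nhdsGT_iff_exists_Ioo_subset.1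
    (hf.eventually_abs_le hε (hP.isCompact_sublevel 1))
  have hlt : ∀ᶠ x in 𝓝 0, P x < δ :=
    hP.continuous.continuousAt.eventually_lt_const (hP0 ▸ hδ)
  filter_upwards [hlt] with x hx
  rcases eq_or_ne x 0 with rfl | hx0
  · rw [hf0, hP0, abs_zero, mul_zero]
  obtain ⟨y, hy, hyx⟩ := hP.exists_opPow_apply_eq hA hx0
  have hle := h ⟨hP.posDef.pos hx0, hx⟩ y hy.le
  rwa [hyx] at hle

end Subhomogeneous

section Local

variable {d : ℕ} {P : E d → ℝ} {A : End d} {φ : (Fin d → ℤ) → ℂ} {ξ₀ : E d} {μ : ℝ}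

/-- The integrand in the Fourier inversion formula for the convolution powers. -/
noncomputable def inversionKernel (φ : (Fin d → ℤ) → ℂ) (n : ℕ) (x : Fin d → ℤ) (ξ : E d) : ℂ :=
  fourier φ ξ ^ n * Complex.exp (-(Complex.I * ((inner ℝ (latticePt x) ξ : ℝ) : ℂ)))

lemma norm_inversionKernel (φ : (Fin d → ℤ) → ℂ) (n : ℕ) (x : Fin d → ℤ) (ξ : E d) :
    ‖inversionKernel φ n x ξ‖ = ‖fourier φ ξ‖ ^ n := by
  rw [inversionKernel, norm_mul, norm_pow, ← mul_neg, ← Complex.ofReal_neg,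
    Complex.norm_exp_I_mul_ofReal, mul_one]

lemma continuous_inversionKernel (hc : Continuous (fourier φ)) (n : ℕ) (x : Fin d → ℤ) :
    Continuous (inversionKernel φ n x) := by
  unfold inversionKernel
  fun_prop

/-- Local decay at `ξ₀` with exponent `μ`: the integrals of the inversion kernels over arbitrarily
small open neighbourhoods of `ξ₀` are `O(n ^ (-μ))`. -/
def HasLocalDecay (φ : (Fin d → ℤ) → ℂ) (x : Fin d → ℤ) (ξ₀ : E d) (μ : ℝ) : Prop :=
  ∀ W ∈ 𝓝 ξ₀, ∃ N ⊆ W, IsOpen N ∧ ξ₀ ∈ N ∧ ∃ C : ℝ, ∀ n : ℕ, 1 ≤ n →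
    ‖∫ ξ in N, inversionKernel φ n x ξ‖ ≤ C * (n : ℝ) ^ (-μ)

lemma setIntegral_image_add_right {F : Type*} [NormedAddCommGroup F] [NormedSpace ℝ F]
    (f : E d → F) (s : Set (E d)) (v : E d) :
    ∫ ξ in (· + v) '' s, f ξ = ∫ ξ in s, f (ξ + v) :=
  (measurePreserving_add_right volume v).setIntegral_image_emb
    (measurableEmbedding_addRight v) f s

lemma IsPositiveHomogeneous.hasLocalDecay_of_sublevel (hP : IsPositiveHomogeneous P)
    {x : Fin d → ℤ} (h : ∀ᶠ b in 𝓝[>] (0 : ℝ), ∃ C : ℝ, ∀ n : ℕ, 1 ≤ n →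
      ‖∫ ξ in {ξ | P ξ < b}, inversionKernel φ n x (ξ + ξ₀)‖ ≤ C * (n : ℝ) ^ (-μ)) :
    HasLocalDecay φ x ξ₀ μ := by
  intro W hW
  rw [← map_add_right_nhds_zero] at hW
  obtain ⟨b, ⟨⟨C, hC⟩, hbW⟩, hb⟩ :=
    ((h.and (hP.eventually_mem_of_lt hW)).and self_mem_nhdsWithin).exists
  obtain ⟨A, hA⟩ := hP.nonempty
  refine ⟨(· + ξ₀) '' {ξ | P ξ < b}, image_subset_iff.2 hbW,
    (Homeomorph.addRight ξ₀).isOpenMap _ (isOpen_lt hP.continuous continuous_const),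
    ⟨0, (IsHomogeneousWrt.map_zero hA).trans_lt hb, zero_add ξ₀⟩, C, fun n hn => ?_⟩
  rw [setIntegral_image_add_right]
  exact hC n hn

section Expansion

variable {U : Set (E d)} {Q R : MvPolynomial (Fin d) ℝ} {Q' R' : E d → ℝ}

lemma IsExpansion.fourier_eq (h : IsExpansion φ ξ₀ U Q R Q' R') {ξ : E d} (hξ : ξ ∈ U) :
    fourier φ (ξ + ξ₀) = fourier φ ξ₀ *
      Complex.exp (Complex.I * ((inner ℝ (drift φ ξ₀) ξ : ℝ) : ℂ)
        - Complex.I * ((polyFun Q ξ + Q' ξ : ℝ) : ℂ) - ((polyFun R ξ + R' ξ : ℝ) : ℂ)) := by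
  have hne : fourier φ ξ₀ ≠ 0 := fun h0 =>
    Complex.slitPlane_ne_zero (h.mem_slitPlane ξ hξ) (by rw [h0, div_zero])
  rw [← h.eq ξ hξ, logRatio, Complex.exp_log (Complex.slitPlane_ne_zero (h.mem_slitPlane ξ hξ)),
    mul_div_cancel₀ _ hne]

lemma IsExpansion.norm_fourier_eq (h : IsExpansion φ ξ₀ U Q R Q' R') (hξ₀ : ‖fourier φ ξ₀‖ = 1)
    {ξ : E d} (hξ : ξ ∈ U) : ‖fourier φ (ξ + ξ₀)‖ = Real.exp (-(polyFun R ξ + R' ξ)) := by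
  rw [h.fourier_eq hξ, norm_mul, hξ₀, one_mul, Complex.norm_exp]
  simp

lemma IsExpansion.eventually_norm_fourier_le (h : IsExpansion φ ξ₀ U Q R Q' R')
    (hξ₀ : ‖fourier φ ξ₀‖ = 1) (hR : IsPositiveHomogeneous (polyFun R))
    (hA : A ∈ expSet (polyFun R)) (hR' : IsSubhomogeneous U R' A) :
    ∀ᶠ ξ in 𝓝 0, ‖fourier φ (ξ + ξ₀)‖ ≤ Real.exp (-(1 / 2 * polyFun R ξ)) := by
  filter_upwards [h.isOpen.mem_nhds h.zero_mem,
    hR.eventually_abs_le_mul hA hR' h.R'_zero one_half_pos] with ξ hξU hξ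
  rw [h.norm_fourier_eq hξ₀ hξU, Real.exp_le_exp]
  linarith [(abs_le.1 hξ).1]

lemma IsExpansion.eventually_norm_fourier_lt_one (h : IsExpansion φ ξ₀ U Q R Q' R')
    (hξ₀ : ‖fourier φ ξ₀‖ = 1) (hR : IsPositiveHomogeneous (polyFun R))
    (hA : A ∈ expSet (polyFun R)) (hR' : IsSubhomogeneous U R' A) :
    ∀ᶠ ξ in 𝓝[≠] ξ₀, ‖fourier φ ξ‖ < 1 := by
  have hle := h.eventually_norm_fourier_le hξ₀ hR hA hR'
  rw [eventually_nhdsWithin_iff, ← map_add_right_nhds_zero, eventually_map]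
  filter_upwards [hle] with ξ hξ hne
  have hξ0 : ξ ≠ 0 := by
    rintro rfl
    exact hne (zero_add ξ₀)
  exact hξ.trans_lt (Real.exp_lt_one_iff.2 (by linarith [hR.posDef.pos hξ0]))

end Expansion

lemma HasPositiveHomogeneousType.eventually_norm_fourier_lt_one
    (h : HasPositiveHomogeneousType φ ξ₀ μ) (hξ₀ : ‖fourier φ ξ₀‖ = 1) :
    ∀ᶠ ξ in 𝓝[≠] ξ₀, ‖fourier φ ξ‖ < 1 := by
  obtain ⟨U, Q, R, Q', R', hE, hR, A, hA, -, hR', -, -⟩ := h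
  exact hE.eventually_norm_fourier_lt_one hξ₀ hR hA hR'

lemma HasImaginaryHomogeneousType.eventually_norm_fourier_lt_one
    (h : HasImaginaryHomogeneousType φ ξ₀ μ) (hξ₀ : ‖fourier φ ξ₀‖ = 1) :
    ∀ᶠ ξ in 𝓝[≠] ξ₀, ‖fourier φ ξ‖ < 1 := by
  obtain ⟨U, Q, R, Q', R', hE, -, hR, A, -, k, -, hA, -, hR', -⟩ := h
  exact hE.eventually_norm_fourier_lt_one hξ₀ hR hA
    (hR'.isSubhomogeneous le_rfl (hR.contracting _ hA) hE.isOpen hE.zero_mem hE.R'_zero)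

lemma HasPositiveHomogeneousType.hasLocalDecay (h : HasPositiveHomogeneousType φ ξ₀ μ)
    (hξ₀ : ‖fourier φ ξ₀‖ = 1) (x : Fin d → ℤ) : HasLocalDecay φ x ξ₀ μ := by
  obtain ⟨U, Q, R, Q', R', hE, hR, A, hA, -, hR', -, rfl⟩ := h
  refine hR.hasLocalDecay_of_sublevel ?_
  filter_upwards [hR.eventually_mem_of_lt (hE.eventually_norm_fourier_le hξ₀ hR hA hR')] with b hb
  refine ⟨(1 / 2) ^ (-tr A) * ∫ ξ, Real.exp (-polyFun R ξ), fun n hn => ?_⟩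
  have hn0 : (0 : ℝ) < n := Nat.cast_pos.2 hn
  have hint := hR.integrable_exp_neg_mul (half_pos hn0)
  have hpt (ξ : E d) (hξ : polyFun R ξ < b) :
      ‖inversionKernel φ n x (ξ + ξ₀)‖ ≤ Real.exp (-(n / 2 * polyFun R ξ)) := by
    rw [norm_inversionKernel, show -(n / 2 * polyFun R ξ) = n * -(1 / 2 * polyFun R ξ) by ring,
      Real.exp_nat_mul]
    exact pow_le_pow_left₀ (norm_nonneg _) (hb ξ hξ) n
  calc ‖∫ ξ in {ξ | polyFun R ξ < b}, inversionKernel φ n x (ξ + ξ₀)‖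
      ≤ ∫ ξ in {ξ | polyFun R ξ < b}, Real.exp (-(n / 2 * polyFun R ξ)) :=
        norm_integral_le_of_norm_le hint.restrict ((ae_restrict_mem
          (isOpen_lt hR.continuous continuous_const).measurableSet).mono hpt)
    _ ≤ ∫ ξ, Real.exp (-(n / 2 * polyFun R ξ)) :=
        setIntegral_le_integral hint (ae_of_all _ fun _ => (Real.exp_pos _).le)
    _ = (1 / 2) ^ (-tr A) * (∫ ξ, Real.exp (-polyFun R ξ)) * (n : ℝ) ^ (-tr A) := by
        rw [IsHomogeneousWrt.integral_exp_neg_mul hA (half_pos hn0), div_eq_mul_one_div,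
          Real.mul_rpow hn0.le one_half_pos.le]
        ring

end Local

section Damping

variable {a b s l M : ℝ}

lemma norm_integral_cexp_I_mul_mul_rpow_smul_cexp_le {L : ℝ} (ha : 0 < a) (hab : a ≤ b)
    (hs : s < 0) (hl : 0 < l) {θ θ' θ'' : ℝ → ℝ} {z z' : ℝ → ℂ}
    (hθ : ∀ t ∈ Icc a b, HasDerivAt θ (θ' t) t) (hθ' : ∀ t ∈ Icc a b, HasDerivAt θ' (θ'' t) t)
    (hz : ∀ t ∈ Icc a b, HasDerivAt z (z' t) t) (hθl : ∀ t ∈ Icc a b, l ≤ |θ' t|)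
    (hθM : ∀ t ∈ Icc a b, |θ'' t| ≤ M * |θ' t| / t)
    (hz1 : ∀ t ∈ Icc a b, ‖Complex.exp (z t)‖ ≤ 1)
    (hzL : ∀ t ∈ Icc a b, ‖Complex.exp (z t)‖ * ‖z' t‖ ≤ L / t) :
    ‖∫ t in a..b, Complex.exp (Complex.I * θ t) * (t ^ s • Complex.exp (z t))‖ ≤
      (1 + L - s) / l * (2 + (1 + M) / -s) * a ^ s := by
  have hL : 0 ≤ L := by
    have h := (mul_nonneg (norm_nonneg _) (norm_nonneg _)).trans (hzL a (left_mem_Icc.2 hab))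
    rwa [le_div_iff₀ ha, zero_mul] at h
  have hpos {t : ℝ} (ht : t ∈ Icc a b) : 0 < t := ha.trans_le ht.1
  refine norm_integral_cexp_I_mul_mul_le ha hab hs hl hθ hθ'
    (fun t ht => (Real.hasDerivAt_rpow_const (Or.inl (hpos ht).ne')).smul (hz t ht).cexp)
    hθl hθM (fun t ht => ?_) (fun t ht => ?_)
  · have hts : 0 < t ^ s := Real.rpow_pos_of_pos (hpos ht) s
    rw [norm_smul, Real.norm_of_nonneg hts.le]
    nlinarith [hz1 t ht]
  · have hts : 0 < t ^ (s - 1) := Real.rpow_pos_of_pos (hpos ht) _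
    have hmain : ‖t ^ s • (Complex.exp (z t) * z' t)‖ ≤ L * t ^ (s - 1) := by
      rw [norm_smul, norm_mul, Real.norm_of_nonneg (Real.rpow_nonneg (hpos ht).le s),
        Real.rpow_sub_one (hpos ht).ne', mul_div_left_comm]
      exact mul_le_mul_of_nonneg_left (hzL t ht) (Real.rpow_nonneg (hpos ht).le s)
    have hrest : ‖(s * t ^ (s - 1)) • Complex.exp (z t)‖ ≤ -s * t ^ (s - 1) := by
      rw [norm_smul, norm_mul, Real.norm_of_nonpos hs.le, Real.norm_of_nonneg hts.le]
      exact mul_le_of_le_one_right (mul_nonneg (neg_nonneg.2 hs.le) hts.le) (hz1 t ht)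
    exact (norm_add_le_of_le hmain hrest).trans (by linarith)

lemma norm_cexp_neg_mul_sub_I_mul (n ρ β : ℝ) :
    ‖Complex.exp (-(n * ρ) - Complex.I * β)‖ = Real.exp (-(n * ρ)) := by
  rw [Complex.norm_exp]
  simp

lemma nonneg_of_abs_le_mul_div {u v t K : ℝ} (ht : 0 < t) (hK : 0 < K) (h : |u| ≤ K * v / t) :
    0 ≤ v := by
  have hle := (abs_nonneg u).trans h
  rw [le_div_iff₀ ht, zero_mul] at hle
  exact nonneg_of_mul_nonneg_right hle hK

lemma norm_cexp_mul_norm_deriv_le {n ρ ρ' β β' t K L : ℝ} (hn : 0 ≤ n) (ht : 0 < t) (hK : 0 < K)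
    (hρ : |ρ'| ≤ K * ρ / t) (hβ : |β'| ≤ L / t) :
    ‖Complex.exp (-(n * ρ) - Complex.I * β)‖ * ‖(-(n * ρ') - Complex.I * β' : ℂ)‖ ≤
      (K + L) / t := by
  have hL : 0 ≤ L := nonneg_of_abs_le_mul_div ht one_pos (by rwa [one_mul])
  have hρ0 : 0 ≤ n * ρ := mul_nonneg hn (nonneg_of_abs_le_mul_div ht hK hρ)
  have hderiv : ‖(-(n * ρ') - Complex.I * β' : ℂ)‖ ≤ (K * (n * ρ) + L) / t :=
    calc ‖(-(n * ρ') - Complex.I * β' : ℂ)‖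
        ≤ ‖(-(n * ρ') : ℂ)‖ + ‖Complex.I * β'‖ := norm_sub_le _ _
      _ = n * |ρ'| + |β'| := by simp [abs_of_nonneg hn]
      _ ≤ n * (K * ρ / t) + L / t := by gcongr
      _ = (K * (n * ρ) + L) / t := by ring
  have hle : Real.exp (-(n * ρ)) * (n * ρ) ≤ 1 := by
    rw [Real.exp_neg, inv_mul_le_one₀ (Real.exp_pos _)]
    linarith [Real.add_one_le_exp (n * ρ)]
  calc ‖Complex.exp (-(n * ρ) - Complex.I * β)‖ * ‖(-(n * ρ') - Complex.I * β' : ℂ)‖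
      ≤ Real.exp (-(n * ρ)) * ((K * (n * ρ) + L) / t) := by
        rw [norm_cexp_neg_mul_sub_I_mul]; gcongr
    _ = (K * (Real.exp (-(n * ρ)) * (n * ρ)) + Real.exp (-(n * ρ)) * L) / t := by ring
    _ ≤ (K * 1 + 1 * L) / t := by
        gcongr
        exact Real.exp_le_one_iff.2 (neg_nonpos.2 hρ0)
    _ = (K + L) / t := by ring

lemma norm_integral_rpow_smul_cexp_le {n K L : ℝ} (ha : 0 < a) (hab : a ≤ b) (hs : s < 0)
    (hl : 0 < l) (hn : 0 < n) (hK : 0 < K) {ψ ψ' ψ'' ρ ρ' β β' : ℝ → ℝ}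
    (hψ : ∀ t ∈ Icc a b, HasDerivAt ψ (ψ' t) t) (hψ' : ∀ t ∈ Icc a b, HasDerivAt ψ' (ψ'' t) t)
    (hρ : ∀ t ∈ Icc a b, HasDerivAt ρ (ρ' t) t) (hβ : ∀ t ∈ Icc a b, HasDerivAt β (β' t) t)
    (hψl : ∀ t ∈ Icc a b, l ≤ |ψ' t|) (hψM : ∀ t ∈ Icc a b, |ψ'' t| ≤ M * |ψ' t| / t)
    (hρK : ∀ t ∈ Icc a b, |ρ' t| ≤ K * ρ t / t) (hβL : ∀ t ∈ Icc a b, |β' t| ≤ L / t) :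
    ‖∫ t in a..b, t ^ s •
        Complex.exp (-(n * ρ t) - Complex.I * β t - Complex.I * (n * ψ t))‖ ≤
      (1 + (K + L) - s) / l * (2 + (1 + M) / -s) / n * a ^ s := by
  have hpos {t : ℝ} (ht : t ∈ Icc a b) : 0 < t := ha.trans_le ht.1
  have hvdC := norm_integral_cexp_I_mul_mul_rpow_smul_cexp_le (l := n * l) (L := K + L) (M := M)
    (z := fun t => -(n * ρ t) - Complex.I * β t) (θ := fun t => -(n * ψ t))
    ha hab hs (mul_pos hn hl)
    (fun t ht => ((hψ t ht).const_mul n).neg) (fun t ht => ((hψ' t ht).const_mul n).neg)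
    (fun t ht => (((hρ t ht).ofReal_comp.const_mul (n : ℂ)).neg).sub
      ((hβ t ht).ofReal_comp.const_mul Complex.I))
    (fun t ht => ?_) (fun t ht => ?_) (fun t ht => ?_)
    (fun t ht => norm_cexp_mul_norm_deriv_le hn.le (hpos ht) hK (hρK t ht) (hβL t ht))
  · refine (le_of_eq ?_).trans (hvdC.trans_eq ?_)
    · congr 1
      refine intervalIntegral.integral_congr fun t _ => ?_
      rw [mul_smul_comm, ← Complex.exp_add]
      congr 2
      push_cast
      ring
    · field_simp
  · rw [abs_neg, abs_mul, abs_of_pos hn]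
    exact mul_le_mul_of_nonneg_left (hψl t ht) hn.le
  · rw [abs_neg, abs_neg, abs_mul, abs_mul, abs_of_pos hn, mul_left_comm, mul_div_assoc]
    exact mul_le_mul_of_nonneg_left (hψM t ht) hn.le
  · rw [norm_cexp_neg_mul_sub_I_mul]
    exact Real.exp_le_one_iff.2 (neg_nonpos.2
      (mul_nonneg hn.le (nonneg_of_abs_le_mul_div (hpos ht) hK (hρK t ht))))

end Damping

section Orbit

variable {d : ℕ} {A : End d} {U S : Set (E d)}

lemma IsHomogeneousWrt.of_abs {Q : E d → ℝ} (hQ : Continuous Q)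
    (hA : IsHomogeneousWrt (fun ξ => |Q ξ|) A) : IsHomogeneousWrt Q A := by
  intro r hr y
  rcases eq_or_ne (Q y) 0 with hy | hy
  · have h := hA r hr y
    simp only [hy, abs_zero, mul_zero] at h
    rw [hy, mul_zero, abs_eq_zero.1 h.symm]
  have horbit : ContinuousOn (fun t => Q (opPow t A y)) (Ioi 0) := hQ.comp_continuousOn fun t ht =>
    (hasDerivAt_opPow_apply ht A y).continuousAt.continuousWithinAt
  have hsq : EqOn ((fun t => Q (opPow t A y)) ^ 2) ((fun t => t * Q y) ^ 2) (Ioi 0) := by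
    intro t ht
    have h : t * |Q y| = |Q (opPow t A y)| := hA t ht y
    rw [Pi.pow_apply, Pi.pow_apply, ← sq_abs, ← h, mul_pow, sq_abs, mul_pow]
  rcases isPreconnected_Ioi.eq_or_eq_neg_of_sq_eq horbit
    (continuous_mul_const (Q y)).continuousOn hsq (fun ht => mul_ne_zero (ne_of_gt ht) hy)
    with h | h
  · exact (h hr).symm
  · have h1 : Q (opPow 1 A y) = -(1 * Q y) := h (mem_Ioi.2 one_pos)
    rw [opPow_one, one_apply_eq_self, one_mul] at h1
    exact absurd (self_eq_neg.1 h1) hy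

lemma continuous_polyFun (p : MvPolynomial (Fin d) ℝ) : Continuous (polyFun p) :=
  (MvPolynomial.continuous_eval p).comp (PiLp.continuous_ofLp 2 _)

lemma IsStronglySubhomogeneous.eventually_le_abs_add_deriv {f Q : E d → ℝ}
    (hf : IsStronglySubhomogeneous 2 U f A) (hS : IsCompact S) (hQ : ∀ y ∈ S, 1 ≤ |Q y|) :
    ∀ᶠ t in 𝓝[>] (0 : ℝ), ∀ y ∈ S,
      1 / 2 ≤ |Q y + deriv (fun s => f (opPow s A y)) t| ∧
      |iteratedDeriv 2 (fun s => f (opPow s A y)) t| ≤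
        1 * |Q y + deriv (fun s => f (opPow s A y)) t| / t := by
  filter_upwards [hf.eventually_abs_deriv_le one_le_two one_half_pos hS,
    hf.eventually_abs_iteratedDeriv_le le_rfl one_half_pos hS, self_mem_nhdsWithin]
    with t hf1 hf2 ht y hy
  have hle : 1 / 2 ≤ |Q y + deriv (fun s => f (opPow s A y)) t| := by
    have htri := abs_sub (Q y + deriv (fun s => f (opPow s A y)) t)
      (deriv (fun s => f (opPow s A y)) t)
    rw [add_sub_cancel_right] at htri
    linarith [hQ y hy, hf1 y hy]
  refine ⟨hle, (hf2 y hy).trans ?_⟩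
  rw [pow_one, one_mul]
  exact div_le_div_of_nonneg_right hle (le_of_lt ht)

lemma eventually_abs_inner_deriv_opPow_le (hA : IsContracting A) (hS : IsCompact S) (v : E d) :
    ∀ᶠ t in 𝓝[>] (0 : ℝ), ∀ y ∈ S, |inner ℝ v (t⁻¹ • A (opPow t A y))| ≤ ‖v‖ * ‖A‖ / t := by
  filter_upwards [hA.eventually_mem hS (Metric.closedBall_mem_nhds 0 one_pos),
    self_mem_nhdsWithin] with t hball (ht : 0 < t) y hy
  calc |inner ℝ v (t⁻¹ • A (opPow t A y))|
      ≤ ‖v‖ * ‖t⁻¹ • A (opPow t A y)‖ := abs_real_inner_le_norm _ _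
    _ = ‖v‖ * (t⁻¹ * ‖A (opPow t A y)‖) := by
        rw [norm_smul, Real.norm_of_nonneg (inv_nonneg.2 ht.le)]
    _ ≤ ‖v‖ * (t⁻¹ * ‖A‖) := by
        gcongr
        exact A.unit_le_opNorm _ (mem_closedBall_zero_iff.1 (hball y hy))
    _ = ‖v‖ * ‖A‖ / t := by ring

lemma hasDerivAt_inner_opPow {t : ℝ} (ht : 0 < t) (v y : E d) :
    HasDerivAt (fun s => inner ℝ v (opPow s A y)) (inner ℝ v (t⁻¹ • A (opPow t A y))) t := by
  simpa only [inner_zero_left, add_zero] using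
    (hasDerivAt_const t v).inner ℝ (hasDerivAt_opPow_apply ht A y)

lemma IsStronglySubhomogeneous.eventually_abs_add_deriv_le {f P : E d → ℝ}
    (hf : IsStronglySubhomogeneous 1 U f A) (hA : IsContracting A) (hU : IsOpen U)
    (h0 : (0 : E d) ∈ U) (hf0 : f 0 = 0) (hS : IsCompact S) {m : ℝ} (hm : 0 < m)
    (hP : ∀ y ∈ S, m ≤ P y) :
    ∀ᶠ r in 𝓝[>] (0 : ℝ), ∀ y ∈ S, |P y + deriv (fun s => f (opPow s A y)) r| ≤
      3 * (r * P y + f (opPow r A y)) / r := by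
  filter_upwards [hf.eventually_abs_deriv_le le_rfl (half_pos hm) hS,
    (hf.isSubhomogeneous le_rfl hA hU h0 hf0).eventually_abs_le (half_pos hm) hS,
    self_mem_nhdsWithin] with r hf1 hf2 (hr : 0 < r) y hy
  have hderiv : |P y + deriv (fun s => f (opPow s A y)) r| ≤ 3 / 2 * P y := by
    have h := abs_le.1 (hf1 y hy)
    exact abs_le.2 ⟨by linarith [hP y hy], by linarith [hP y hy]⟩
  have hvalue : 1 / 2 * (r * P y) ≤ r * P y + f (opPow r A y) := by
    nlinarith [hP y hy, (abs_le.1 (hf2 y hy)).1]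
  rw [le_div_iff₀ hr]
  nlinarith

end Orbit

section Imaginary

variable {d : ℕ} {A : End d} {φ : (Fin d → ℤ) → ℂ} {ξ₀ : E d} {U : Set (E d)}
  {Q R : MvPolynomial (Fin d) ℝ} {Q' R' : E d → ℝ} {a b k μ : ℝ}

lemma IsExpansion.inversionKernel_add (h : IsExpansion φ ξ₀ U Q R Q' R') (hdrift : drift φ ξ₀ = 0)
    {ξ : E d} (hξ : ξ ∈ U) (n : ℕ) (x : Fin d → ℤ) :
    inversionKernel φ n x (ξ + ξ₀) = inversionKernel φ n x ξ₀ *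
      Complex.exp (-((n : ℝ) * (polyFun R ξ + R' ξ : ℝ)) -
        Complex.I * (inner ℝ (latticePt x) ξ : ℝ) -
        Complex.I * ((n : ℝ) * (polyFun Q ξ + Q' ξ : ℝ))) := by
  rw [inversionKernel, inversionKernel, h.fourier_eq hξ, hdrift, inner_zero_left, inner_add_right,
    mul_pow, mul_assoc, mul_assoc, ← Complex.exp_nat_mul, ← Complex.exp_add, ← Complex.exp_add]
  congr 2
  push_cast
  ring

lemma IsExpansion.inversionKernel_opPow_add (h : IsExpansion φ ξ₀ U Q R Q' R')
    (hdrift : drift φ ξ₀ = 0) (hQA : IsHomogeneousWrt (polyFun Q) A) (hk : 0 < k)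
    (hRA : IsHomogeneousWrt (polyFun R) (k⁻¹ • A)) {t : ℝ} (ht : 0 < t) {y : E d}
    (hy : opPow t A y ∈ U) (n : ℕ) (x : Fin d → ℤ) :
    inversionKernel φ n x (opPow t A y + ξ₀) = inversionKernel φ n x ξ₀ * Complex.exp
      (-((n : ℝ) * (t ^ k * polyFun R y + R' (opPow (t ^ k) (k⁻¹ • A) y) : ℝ)) -
        Complex.I * (inner ℝ (latticePt x) (opPow t A y) : ℝ) -
        Complex.I * ((n : ℝ) * (t * polyFun Q y + Q' (opPow t A y) : ℝ))) := by
  rw [h.inversionKernel_add hdrift hy, hQA.apply_opPow ht,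
    ← hRA.apply_opPow (Real.rpow_pos_of_pos ht k), opPow_rpow_inv_smul ht hk.ne']

lemma hasDerivAt_comp_rpow {f : ℝ → ℝ} {c t : ℝ} (ht : 0 < t)
    (hf : DifferentiableAt ℝ f (t ^ k)) :
    HasDerivAt (fun s => s ^ k * c + f (s ^ k)) ((c + deriv f (t ^ k)) * (k * t ^ (k - 1))) t := by
  have hpow : HasDerivAt (fun s : ℝ => s ^ k) (k * t ^ (k - 1)) t :=
    Real.hasDerivAt_rpow_const (Or.inl ht.ne')
  exact ((hasDerivAt_mul_const c).add hf.hasDerivAt).comp t hpow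

lemma abs_mul_deriv_rpow_le {t u v K : ℝ} (ht : 0 < t) (hk : 0 < k) (h : |u| ≤ K * v / t ^ k) :
    |u * (k * t ^ (k - 1))| ≤ K * k * v / t := by
  have hfac : 0 < k * t ^ (k - 1) := mul_pos hk (Real.rpow_pos_of_pos ht _)
  rw [abs_mul, abs_of_pos hfac]
  refine (mul_le_mul_of_nonneg_right h hfac.le).trans_eq ?_
  rw [Real.rpow_sub_one ht.ne']
  field_simp

lemma IsExpansion.norm_integral_orbit_le (h : IsExpansion φ ξ₀ U Q R Q' R')
    (hξ₀ : ‖fourier φ ξ₀‖ = 1) (hdrift : drift φ ξ₀ = 0) (hQA : IsHomogeneousWrt (polyFun Q) A)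
    (hk : 0 < k) (hRA : IsHomogeneousWrt (polyFun R) (k⁻¹ • A)) (hμ : μ < 1) (ha : 0 < a)
    (hab : a ≤ b) {n : ℕ} (hn : 1 ≤ n) (x : Fin d → ℤ) {y : E d} {L : ℝ}
    (hU : ∀ t ∈ Icc a b, opPow t A y ∈ U)
    (hphase : ∀ t ∈ Icc a b, 1 / 2 ≤ |polyFun Q y + deriv (fun s => Q' (opPow s A y)) t| ∧
      |iteratedDeriv 2 (fun s => Q' (opPow s A y)) t| ≤
        1 * |polyFun Q y + deriv (fun s => Q' (opPow s A y)) t| / t)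
    (hdamp : ∀ t ∈ Icc a b,
      |polyFun R y + deriv (fun s => R' (opPow s (k⁻¹ • A) y)) (t ^ k)| ≤
        3 * (t ^ k * polyFun R y + R' (opPow (t ^ k) (k⁻¹ • A) y)) / t ^ k)
    (hinner : ∀ t ∈ Icc a b, |inner ℝ (latticePt x) (t⁻¹ • A (opPow t A y))| ≤ L / t) :
    ‖∫ t in a..b, t ^ (μ - 1) • inversionKernel φ n x (opPow t A y + ξ₀)‖ ≤
      (1 + (3 * k + L) - (μ - 1)) / (1 / 2) * (2 + (1 + 1) / -(μ - 1)) / n * a ^ (μ - 1) := by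
  have hpos {t : ℝ} (ht : t ∈ Icc a b) : 0 < t := ha.trans_le ht.1
  have hsmooth : ∀ t ∈ Icc a b, ContDiffAt ℝ ∞ (fun s => Q' (opPow s A y)) t := fun t ht =>
    contDiffAt_comp_opPow h.smooth_Q' h.isOpen (hpos ht) (hU t ht)
  have hIcc {t : ℝ} (ht : t ∈ uIcc a b) : t ∈ Icc a b := by rwa [uIcc_of_le hab] at ht
  rw [intervalIntegral.integral_congr fun t ht => (congrArg (t ^ (μ - 1) • ·)
      (h.inversionKernel_opPow_add hdrift hQA hk hRA (hpos (hIcc ht)) (hU t (hIcc ht)) n x)).trans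
      (mul_smul_comm _ _ _).symm,
    intervalIntegral.integral_const_mul, norm_mul, norm_inversionKernel, hξ₀, one_pow, one_mul]
  refine norm_integral_rpow_smul_cexp_le ha hab (by linarith) one_half_pos (Nat.cast_pos.2 hn)
    (mul_pos three_pos hk)
    (fun t ht => (hasDerivAt_mul_const _).add
      ((hsmooth t ht).differentiableAt (by simp)).hasDerivAt)
    (fun t ht => ?_)
    (fun t ht => hasDerivAt_comp_rpow (f := fun r => R' (opPow r (k⁻¹ • A) y)) (hpos ht) ?_)
    (fun t ht => hasDerivAt_inner_opPow (hpos ht) _ y)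
    (fun t ht => (hphase t ht).1) (fun t ht => (hphase t ht).2)
    (fun t ht => abs_mul_deriv_rpow_le (hpos ht) hk (hdamp t ht)) hinner
  · rw [iteratedDeriv_succ, iteratedDeriv_one]
    have hderiv : ContDiffAt ℝ 1 (deriv fun s => Q' (opPow s A y)) t :=
      ((hsmooth t ht).of_le (m := 2) ENat.LEInfty.out).derivWithin (by norm_num)
    exact (hderiv.differentiableAt one_ne_zero).hasDerivAt.const_add _
  · have hmem : opPow (t ^ k) (k⁻¹ • A) y ∈ U := by
      rw [opPow_rpow_inv_smul (hpos ht) hk.ne']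
      exact hU t ht
    exact (contDiffAt_comp_opPow h.smooth_R' h.isOpen (Real.rpow_pos_of_pos (hpos ht) k)
      hmem).differentiableAt (by simp)

lemma eventually_forall_Ioc {p : ℝ → Prop} (h : ∀ᶠ t in 𝓝[>] (0 : ℝ), p t) :
    ∀ᶠ b in 𝓝[>] (0 : ℝ), ∀ t ∈ Ioc 0 b, p t := by
  obtain ⟨δ, hδ, hp⟩ := mem_nhdsGT_iff_exists_Ioo_subset.1 h
  filter_upwards [Ioo_mem_nhdsGT hδ] with b hb t ht using hp ⟨ht.1, ht.2.trans_lt hb.2⟩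

lemma tendsto_rpow_nhdsGT_zero (hk : 0 < k) :
    Tendsto (fun t : ℝ => t ^ k) (𝓝[>] 0) (𝓝[>] 0) := by
  have h := (Real.continuousAt_rpow_const 0 k (Or.inr hk.le)).tendsto
  rw [Real.zero_rpow hk.ne'] at h
  exact tendsto_nhdsWithin_iff.2 ⟨tendsto_nhdsWithin_of_tendsto_nhds h,
    eventually_nhdsWithin_of_forall fun t ht => Real.rpow_pos_of_pos ht k⟩

lemma IsExpansion.exists_eventually_norm_integral_orbit_le (h : IsExpansion φ ξ₀ U Q R Q' R')
    (hξ₀ : ‖fourier φ ξ₀‖ = 1) (hdrift : drift φ ξ₀ = 0)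
    (hQ : IsPositiveHomogeneous fun ξ => |polyFun Q ξ|) (hR : IsPositiveHomogeneous (polyFun R))
    (hA : A ∈ expSet fun ξ => |polyFun Q ξ|) (hk : 0 < k)
    (hRA : IsHomogeneousWrt (polyFun R) (k⁻¹ • A)) (hQ' : IsStronglySubhomogeneous 2 U Q' A)
    (hR' : IsStronglySubhomogeneous 1 U R' (k⁻¹ • A)) (hμ : μ < 1) (x : Fin d → ℤ) :
    ∃ C : ℝ, 0 ≤ C ∧ ∀ᶠ B in 𝓝[>] (0 : ℝ), ∀ n : ℕ, 1 ≤ n → ∀ a b, 0 < a → a ≤ b → b ≤ B →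
      ∀ y ∈ annulus (fun ξ => |polyFun Q ξ|) 1 2,
        ‖∫ t in a..b, t ^ (μ - 1) • inversionKernel φ n x (opPow t A y + ξ₀)‖ ≤
          C / n * a ^ (μ - 1) := by
  have hQA : IsHomogeneousWrt (polyFun Q) A := .of_abs (continuous_polyFun Q) hA
  have hS : IsCompact ({y | |polyFun Q y| ≤ 2} ∩ {y | 1 ≤ |polyFun Q y|}) :=
    (hQ.isCompact_sublevel 2).inter_right (isClosed_le continuous_const hQ.continuous)
  obtain ⟨m, hm, hmS⟩ := hS.exists_forall_le' hR.continuous.continuousOn (a := 0)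
    fun y hy => hR.posDef.pos fun hy0 => by
      have h1 : 1 ≤ |polyFun Q y| := hy.2
      rw [hy0, hQA.map_zero, abs_zero] at h1
      exact not_lt.2 h1 one_pos
  have hcontr := hQ.contracting A hA
  have hmem := hcontr.eventually_mem hS (h.isOpen.mem_nhds h.zero_mem)
  have hphase := hQ'.eventually_le_abs_add_deriv hS fun y hy => hy.2
  have hdamp := (tendsto_rpow_nhdsGT_zero hk).eventually (hR'.eventually_abs_add_deriv_le
    (hR.contracting _ hRA) h.isOpen h.zero_mem h.R'_zero hS hm hmS)
  have hinner := eventually_abs_inner_deriv_opPow_le hcontr hS (latticePt x)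
  have hs : 0 < -(μ - 1) := by linarith
  refine ⟨(1 + (3 * k + ‖latticePt x‖ * ‖A‖) - (μ - 1)) / (1 / 2) * (2 + (1 + 1) / -(μ - 1)),
    by rw [sub_eq_add_neg _ (μ - 1)]; positivity, ?_⟩
  filter_upwards [eventually_forall_Ioc (hmem.and (hphase.and (hdamp.and hinner)))]
    with B hB n hn a b ha hab hbB y hy
  have hIoc {t : ℝ} (ht : t ∈ Icc a b) : t ∈ Ioc 0 B := ⟨ha.trans_le ht.1, ht.2.trans hbB⟩
  exact h.norm_integral_orbit_le hξ₀ hdrift hQA hk hRA hμ ha hab hn x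
    (fun t ht => (hB t (hIoc ht)).1 y ⟨hy.2.le, hy.1⟩)
    (fun t ht => (hB t (hIoc ht)).2.1 y ⟨hy.2.le, hy.1⟩)
    (fun t ht => (hB t (hIoc ht)).2.2.1 y ⟨hy.2.le, hy.1⟩)
    (fun t ht => (hB t (hIoc ht)).2.2.2 y ⟨hy.2.le, hy.1⟩)

-- Split at the level `|Q| = b / n`: the volume below it is already of order `n ^ (-μ)`.
lemma HasImaginaryHomogeneousType.hasLocalDecay (h : HasImaginaryHomogeneousType φ ξ₀ μ)
    (hξ₀ : ‖fourier φ ξ₀‖ = 1) (hc : Continuous (fourier φ)) (hdrift : drift φ ξ₀ = 0)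
    (hμ : μ < 1) (x : Fin d → ℤ) : HasLocalDecay φ x ξ₀ μ := by
  obtain ⟨U, Q, R, Q', R', hE, hQ, hR, A, hA, k, hk, hRA, hQ', hR', rfl⟩ := h
  have hk0 : 0 < k := one_pos.trans hk
  have hR'' := hR'.isSubhomogeneous le_rfl (hR.contracting _ hRA) hE.isOpen hE.zero_mem hE.R'_zero
  obtain ⟨C, hC, horbit⟩ := hE.exists_eventually_norm_integral_orbit_le hξ₀ hdrift hQ hR hA hk0
    hRA hQ' hR' hμ x
  refine hQ.hasLocalDecay_of_sublevel ?_
  filter_upwards [hQ.eventually_mem_of_lt (hE.eventually_norm_fourier_le hξ₀ hR hRA hR''), horbit,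
    self_mem_nhdsWithin] with b hle horbit (hb : 0 < b)
  refine ⟨b ^ tr A * volume.real {ξ | |polyFun Q ξ| ≤ 1} + C * (b / 2) ^ (tr A - 1) *
    volume.real (annulus (fun ξ => |polyFun Q ξ|) 1 2) / Real.log 2, fun n hn => ?_⟩
  have hn0 : (0 : ℝ) < n := Nat.cast_pos.2 hn
  have hcont : Continuous fun ξ => inversionKernel φ n x (ξ + ξ₀) :=
    (continuous_inversionKernel hc n x).comp (continuous_add_const ξ₀)
  have hker (ξ : E d) (hξ : |polyFun Q ξ| < b) : ‖inversionKernel φ n x (ξ + ξ₀)‖ ≤ 1 := by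
    rw [norm_inversionKernel]
    exact pow_le_one₀ (norm_nonneg _) ((hle ξ hξ).trans
      (Real.exp_le_one_iff.2 (by linarith [hR.posDef.1 ξ])))
  refine (hQ.norm_setIntegral_sublevel_le hA hcont hker (div_pos hb hn0)
    (div_le_self hb.le (Nat.one_le_cast.2 hn)) (M := C / n * (b / 2 / n) ^ (tr A - 1))
    fun y hy => ?_).trans_eq ?_
  · have hy0 : 0 < |polyFun Q y| := one_pos.trans_le hy.1
    have hlower : b / 2 / n ≤ b / n / |polyFun Q y| := by
      rw [div_right_comm]
      exact div_le_div_of_nonneg_left (div_pos hb hn0).le hy0 hy.2.le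
    have hab : b / n / |polyFun Q y| ≤ b / |polyFun Q y| :=
      div_le_div_of_nonneg_right (div_le_self hb.le (Nat.one_le_cast.2 hn)) hy0.le
    rw [integral_Ico_eq_integral_Ioc, ← intervalIntegral.integral_of_le hab]
    refine (horbit n hn _ _ (div_pos (div_pos hb hn0) hy0) hab (div_le_self hb.le hy.1) y hy).trans
      (mul_le_mul_of_nonneg_left ?_ (div_nonneg hC hn0.le))
    exact Real.rpow_le_rpow_of_nonpos (div_pos (half_pos hb) hn0) hlower (by linarith)
  · rw [Real.div_rpow hb.le hn0.le, Real.div_rpow (half_pos hb).le hn0.le,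
      Real.rpow_sub_one hn0.ne', Real.rpow_neg hn0.le]
    field_simp

end Imaginary

section Convolution

variable {d : ℕ} {ψ φ : (Fin d → ℤ) → ℂ}

lemma MemS.summable_norm (hφ : MemS φ) : Summable fun x => ‖φ x‖ := by
  simpa only [Pi.zero_apply, pow_zero, Finset.prod_const_one, one_mul] using hφ 0

lemma summable_norm_mul_sub (hψ : Summable fun x => ‖ψ x‖) (hφ : Summable fun x => ‖φ x‖) :
    Summable fun p : (Fin d → ℤ) × (Fin d → ℤ) => ‖ψ (p.2 - p.1) * φ p.1‖ := by
  refine ((hφ.mul_of_nonneg hψ (fun _ => norm_nonneg _) fun _ => norm_nonneg _).comp_injective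
    (Equiv.prodShear (Equiv.refl _) Equiv.subRight).injective).congr fun p => ?_
  rw [norm_mul, mul_comm]
  rfl

lemma summable_norm_conv (hψ : Summable fun x => ‖ψ x‖) (hφ : Summable fun x => ‖φ x‖) :
    Summable fun x => ‖conv ψ φ x‖ := by
  have h := (summable_norm_mul_sub hψ hφ).prod_symm
  exact h.prod.of_nonneg_of_le (fun _ => norm_nonneg _) fun x =>
    norm_tsum_le_tsum_norm (h.prod_factor x)

lemma summable_norm_mul_exp (hφ : Summable fun x => ‖φ x‖) (ξ : E d) : Summable fun x =>
    ‖φ x * Complex.exp (Complex.I * ((inner ℝ (latticePt x) ξ : ℝ) : ℂ))‖ := by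
  simpa only [norm_mul, Complex.norm_exp_I_mul_ofReal, mul_one] using hφ

lemma latticePt_sub (x y : Fin d → ℤ) : latticePt (x - y) = latticePt x - latticePt y := by
  ext i
  simp [latticePt]

lemma exp_I_mul_inner_latticePt_sub (x y : Fin d → ℤ) (ξ : E d) :
    Complex.exp (Complex.I * ((inner ℝ (latticePt (y - x)) ξ : ℝ) : ℂ)) =
      Complex.exp (Complex.I * ((inner ℝ (latticePt y) ξ : ℝ) : ℂ)) *
        Complex.exp (-(Complex.I * ((inner ℝ (latticePt x) ξ : ℝ) : ℂ))) := by
  rw [← Complex.exp_add, latticePt_sub, inner_sub_left]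
  congr 1
  push_cast
  ring

lemma fourier_conv (hψ : Summable fun x => ‖ψ x‖) (hφ : Summable fun x => ‖φ x‖) (ξ : E d) :
    fourier (conv ψ φ) ξ = fourier ψ ξ * fourier φ ξ := by
  let e (x : Fin d → ℤ) : ℂ := Complex.exp (Complex.I * ((inner ℝ (latticePt x) ξ : ℝ) : ℂ))
  have he (x y : Fin d → ℤ) : φ y * e y * (ψ (x - y) * e (x - y)) = ψ (x - y) * φ y * e x := by
    simp only [e, exp_I_mul_inner_latticePt_sub, Complex.exp_neg]
    field_simp
  have hsum : Summable (Function.uncurry fun y x => ψ (x - y) * φ y * e x) := by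
    refine Summable.of_norm ((summable_norm_mul_sub hψ hφ).congr fun p => ?_)
    simp only [Function.uncurry, e, norm_mul, Complex.norm_exp_I_mul_ofReal, mul_one]
  calc fourier (conv ψ φ) ξ
      = ∑' x, ∑' y, ψ (x - y) * φ y * e x := tsum_congr fun x => tsum_mul_right.symm
    _ = ∑' y, ∑' x, ψ (x - y) * φ y * e x := hsum.tsum_comm
    _ = ∑' p : (Fin d → ℤ) × (Fin d → ℤ), ψ (p.2 - p.1) * φ p.1 * e p.2 := hsum.tsum_prod.symm
    _ = ∑' p : (Fin d → ℤ) × (Fin d → ℤ), φ p.1 * e p.1 * (ψ p.2 * e p.2) := by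
        rw [← (Equiv.prodShear (Equiv.refl _) Equiv.subRight).tsum_eq
          fun p => φ p.1 * e p.1 * (ψ p.2 * e p.2)]
        exact tsum_congr fun p => (he p.2 p.1).symm
    _ = fourier φ ξ * fourier ψ ξ := (tsum_mul_tsum_of_summable_norm
        (summable_norm_mul_exp hφ ξ) (summable_norm_mul_exp hψ ξ)).symm
    _ = fourier ψ ξ * fourier φ ξ := mul_comm _ _

lemma summable_norm_convPow (hφ : Summable fun x => ‖φ x‖) (n : ℕ) :
    Summable fun x => ‖convPow φ n x‖ := by
  induction n with
  | zero =>
    exact (hasSum_single 0 fun x hx => by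
      rw [convPow, Pi.single_eq_of_ne hx, norm_zero]).summable
  | succ n ih => exact summable_norm_conv ih hφ

lemma fourier_convPow (hφ : Summable fun x => ‖φ x‖) (n : ℕ) (ξ : E d) :
    fourier (convPow φ n) ξ = fourier φ ξ ^ n := by
  induction n with
  | zero =>
    rw [fourier, tsum_eq_single 0 fun x hx => by rw [convPow, Pi.single_eq_of_ne hx, zero_mul]]
    simp [convPow, latticePt, PiLp.inner_apply]
  | succ n ih => rw [convPow, fourier_conv (summable_norm_convPow hφ n) hφ, ih, pow_succ]

lemma continuous_fourier (hφ : Summable fun x => ‖φ x‖) : Continuous (fourier φ) :=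
  continuous_tsum (fun x => by fun_prop) hφ fun x ξ => by
    rw [norm_mul, Complex.norm_exp_I_mul_ofReal, mul_one]

end Convolution

section Cube

variable {d : ℕ} {φ : (Fin d → ℤ) → ℂ}

/-- The half-open cube of side `2π` centred at `a`, a fundamental domain for the lattice of
periods of the Fourier transform. -/
def cube (a : Fin d → ℝ) : Set (E d) :=
  {ξ | ∀ i, ξ i ∈ Ioc (a i - Real.pi) (a i + Real.pi)}

lemma cube_eq_preimage (a : Fin d → ℝ) :
    cube a = WithLp.ofLp ⁻¹' univ.pi fun i => Ioc (a i - Real.pi) (a i + Real.pi) := by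
  ext ξ
  simp only [cube, mem_ofPred_eq, mem_preimage, mem_univ_pi]

lemma isCompact_setOf_forall_mem_Icc (a : Fin d → ℝ) :
    IsCompact {ξ : E d | ∀ i, ξ i ∈ Icc (a i - Real.pi) (a i + Real.pi)} := by
  convert! (EuclideanSpace.equiv (Fin d) ℝ).toHomeomorph.isCompact_preimage.2
    (isCompact_univ_pi fun i => isCompact_Icc (a := a i - Real.pi) (b := a i + Real.pi)) using 1
  ext ξ
  simp only [mem_ofPred_eq, mem_preimage, mem_univ_pi]
  rfl

lemma closure_cube_subset (a : Fin d → ℝ) :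
    closure (cube a) ⊆ {ξ | ∀ i, ξ i ∈ Icc (a i - Real.pi) (a i + Real.pi)} :=
  closure_minimal (fun _ hξ i => Ioc_subset_Icc_self (hξ i))
    (isCompact_setOf_forall_mem_Icc a).isClosed

lemma isBounded_cube (a : Fin d → ℝ) : Bornology.IsBounded (cube a) :=
  (isCompact_setOf_forall_mem_Icc a).isBounded.subset
    (subset_closure.trans (closure_cube_subset a))

lemma setOf_forall_mem_Ioo_subset_interior_cube (a : Fin d → ℝ) :
    {ξ | ∀ i, ξ i ∈ Ioo (a i - Real.pi) (a i + Real.pi)} ⊆ interior (cube a) := by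
  refine interior_maximal (fun _ hξ i => Ioo_subset_Ioc_self (hξ i)) ?_
  simp only [ofPred_forall]
  exact isOpen_iInter_of_finite fun i => isOpen_Ioo.preimage (by fun_prop)

lemma exists_add_latticePt_mem_cube (a : Fin d → ℝ) (ξ : E d) :
    ∃ m : Fin d → ℤ, ξ + (2 * Real.pi) • latticePt m ∈ cube a := by
  choose m hm using fun i =>
    (existsUnique_add_zsmul_mem_Ioc Real.two_pi_pos (ξ i) (a i - Real.pi)).exists
  refine ⟨m, fun i => ?_⟩
  have hmi := hm i
  rw [show a i - Real.pi + 2 * Real.pi = a i + Real.pi by ring] at hmi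
  simpa [latticePt, mul_comm] using hmi

lemma integral_exp_int_mul (k : ℤ) (c : ℝ) :
    ∫ t in Ioc (c - Real.pi) (c + Real.pi), Complex.exp (Complex.I * ((k * t : ℝ) : ℂ)) =
      if k = 0 then (2 * Real.pi : ℂ) else 0 := by
  rw [← intervalIntegral.integral_of_le (by linarith [Real.pi_pos])]
  split_ifs with hk
  · simp [hk]
    ring
  · have hne : Complex.I * (k : ℂ) ≠ 0 :=
      mul_ne_zero Complex.I_ne_zero (Int.cast_ne_zero.2 hk)
    simp only [Complex.ofReal_mul, Complex.ofReal_intCast, ← mul_assoc]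
    rw [integral_exp_mul_complex hne, div_eq_zero_iff, sub_eq_zero]
    refine Or.inl (Complex.exp_eq_exp_iff_exists_int.2 ⟨k, ?_⟩)
    push_cast
    ring

lemma exp_I_mul_inner_latticePt (x : Fin d → ℤ) (ξ : E d) :
    Complex.exp (Complex.I * ((inner ℝ (latticePt x) ξ : ℝ) : ℂ)) =
      ∏ i, Complex.exp (Complex.I * ((x i * ξ i : ℝ) : ℂ)) := by
  simp only [← Complex.exp_sum, ← Finset.mul_sum, ← Complex.ofReal_sum]
  simp [latticePt, PiLp.inner_apply, mul_comm]

lemma setIntegral_cube_exp (a : Fin d → ℝ) (x : Fin d → ℤ) :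
    ∫ ξ in cube a, Complex.exp (Complex.I * ((inner ℝ (latticePt x) ξ : ℝ) : ℂ)) =
      if x = 0 then (2 * Real.pi : ℂ) ^ d else 0 := by
  simp only [exp_I_mul_inner_latticePt]
  rw [cube_eq_preimage, (PiLp.volume_preserving_ofLp (Fin d)).setIntegral_preimage_emb
    (MeasurableEquiv.toLp 2 (Fin d → ℝ)).symm.measurableEmbedding
    (fun y : Fin d → ℝ => ∏ i, Complex.exp (Complex.I * ((x i * y i : ℝ) : ℂ))),
    volume_pi, Measure.restrict_pi_pi, integral_fintype_prod_eq_prod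
      fun i (t : ℝ) => Complex.exp (Complex.I * ((x i * t : ℝ) : ℂ))]
  simp only [integral_exp_int_mul]
  split_ifs with hx
  · simp [hx]
  · obtain ⟨i, hi⟩ := Function.ne_iff.1 hx
    exact Finset.prod_eq_zero (Finset.mem_univ i) (if_neg hi)

lemma setIntegral_cube_fourier_mul_exp (hφ : Summable fun x => ‖φ x‖) (a : Fin d → ℝ)
    (x : Fin d → ℤ) :
    ∫ ξ in cube a, fourier φ ξ * Complex.exp (-(Complex.I * ((inner ℝ (latticePt x) ξ : ℝ) : ℂ))) =
      (2 * Real.pi : ℂ) ^ d * φ x := by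
  have hfin : volume (cube a) < ⊤ := (isBounded_cube a).measure_lt_top
  have hnorm (y : Fin d → ℤ) (ξ : E d) :
      ‖φ y * Complex.exp (Complex.I * ((inner ℝ (latticePt (y - x)) ξ : ℝ) : ℂ))‖ = ‖φ y‖ := by
    rw [norm_mul, Complex.norm_exp_I_mul_ofReal, mul_one]
  have hint (y : Fin d → ℤ) : IntegrableOn
      (fun ξ => φ y * Complex.exp (Complex.I * ((inner ℝ (latticePt (y - x)) ξ : ℝ) : ℂ)))
      (cube a) := by
    refine IntegrableOn.of_bound hfin ?_ ‖φ y‖ (Eventually.of_forall fun ξ => (hnorm y ξ).le)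
    exact (by fun_prop : Continuous _).aestronglyMeasurable
  have hsum := hasSum_integral_of_summable_integral_norm hint (by
    simpa only [hnorm, setIntegral_const, smul_eq_mul] using hφ.mul_left (volume.real (cube a)))
  calc ∫ ξ in cube a,
        fourier φ ξ * Complex.exp (-(Complex.I * ((inner ℝ (latticePt x) ξ : ℝ) : ℂ)))
      = ∫ ξ in cube a, ∑' y,
          φ y * Complex.exp (Complex.I * ((inner ℝ (latticePt (y - x)) ξ : ℝ) : ℂ)) := by
        simp only [exp_I_mul_inner_latticePt_sub, ← mul_assoc, tsum_mul_right, fourier]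
    _ = ∑' y, φ y * if y - x = 0 then (2 * Real.pi : ℂ) ^ d else 0 := by
        rw [← hsum.tsum_eq]
        simp only [integral_const_mul, setIntegral_cube_exp]
    _ = (2 * Real.pi : ℂ) ^ d * φ x := by
        rw [tsum_eq_single x fun y hy => by rw [if_neg (sub_ne_zero.2 hy), mul_zero],
          sub_self, if_pos rfl, mul_comm]

lemma setIntegral_cube_inversionKernel (hφ : Summable fun x => ‖φ x‖) (a : Fin d → ℝ) (n : ℕ)
    (x : Fin d → ℤ) :
    ∫ ξ in cube a, inversionKernel φ n x ξ = (2 * Real.pi : ℂ) ^ d * convPow φ n x := by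
  simp only [inversionKernel, ← fourier_convPow hφ]
  exact setIntegral_cube_fourier_mul_exp (summable_norm_convPow hφ n) a x

end Cube

section Periodicity

variable {d : ℕ} {φ : (Fin d → ℤ) → ℂ} {μ : ℝ} {x : Fin d → ℤ} {ξ : E d}

lemma inner_latticePt_latticePt (x m : Fin d → ℤ) :
    inner ℝ (latticePt x) (latticePt m) = ((∑ i, x i * m i : ℤ) : ℝ) := by
  simp [latticePt, PiLp.inner_apply, mul_comm]

lemma exp_I_mul_inner_add_latticePt (x m : Fin d → ℤ) (ξ : E d) :
    Complex.exp (Complex.I * ((inner ℝ (latticePt x) (ξ + (2 * Real.pi) • latticePt m) : ℝ) : ℂ)) =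
      Complex.exp (Complex.I * ((inner ℝ (latticePt x) ξ : ℝ) : ℂ)) := by
  rw [inner_add_right, inner_smul_right, inner_latticePt_latticePt]
  refine Complex.exp_eq_exp_iff_exists_int.2 ⟨∑ i, x i * m i, ?_⟩
  push_cast
  ring

lemma fourier_add_latticePt (φ : (Fin d → ℤ) → ℂ) (m : Fin d → ℤ) (ξ : E d) :
    fourier φ (ξ + (2 * Real.pi) • latticePt m) = fourier φ ξ := by
  simp only [fourier, exp_I_mul_inner_add_latticePt]

lemma inversionKernel_add_latticePt (φ : (Fin d → ℤ) → ℂ) (n : ℕ) (x m : Fin d → ℤ) (ξ : E d) :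
    inversionKernel φ n x (ξ + (2 * Real.pi) • latticePt m) = inversionKernel φ n x ξ := by
  simp only [inversionKernel, fourier_add_latticePt, Complex.exp_neg,
    exp_I_mul_inner_add_latticePt]

lemma HasLocalDecay.add_latticePt (h : HasLocalDecay φ x ξ μ) (m : Fin d → ℤ) :
    HasLocalDecay φ x (ξ + (2 * Real.pi) • latticePt m) μ := by
  intro W hW
  rw [← map_add_right_nhds] at hW
  obtain ⟨N, hNW, hN, hξN, C, hC⟩ := h _ hW
  refine ⟨(· + (2 * Real.pi) • latticePt m) '' N, image_subset_iff.2 hNW,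
    (Homeomorph.addRight _).isOpenMap _ hN, mem_image_of_mem _ hξN, C, fun n hn => ?_⟩
  simpa only [setIntegral_image_add_right, inversionKernel_add_latticePt] using hC n hn

lemma HasLocalDecay.mono {ν : ℝ} (h : HasLocalDecay φ x ξ μ) (hν : ν ≤ μ) :
    HasLocalDecay φ x ξ ν := by
  intro W hW
  obtain ⟨N, hNW, hN, hξN, C, hC⟩ := h W hW
  refine ⟨N, hNW, hN, hξN, |C|, fun n hn => (hC n hn).trans ?_⟩
  have h1 : (1 : ℝ) ≤ n := by exact_mod_cast hn
  gcongr
  exact le_abs_self C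

/-- The points of `ℝ^d` at which the Fourier transform has modulus `1`: the periodization of
`Ω(φ)`. -/
def peakSet (φ : (Fin d → ℤ) → ℂ) : Set (E d) :=
  {ξ | ‖fourier φ ξ‖ = 1}

lemma isClosed_peakSet (hc : Continuous (fourier φ)) : IsClosed (peakSet φ) :=
  isClosed_eq hc.norm continuous_const

lemma maxSet_eq_cube_inter_peakSet (φ : (Fin d → ℤ) → ℂ) : maxSet φ = cube 0 ∩ peakSet φ := by
  ext ξ
  simp [maxSet, cube, peakSet]

lemma exists_add_latticePt_mem_maxSet (hξ : ξ ∈ peakSet φ) :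
    ∃ m : Fin d → ℤ, ξ + (2 * Real.pi) • latticePt m ∈ maxSet φ := by
  obtain ⟨m, hm⟩ := exists_add_latticePt_mem_cube 0 ξ
  rw [maxSet_eq_cube_inter_peakSet]
  exact ⟨m, hm, by rwa [peakSet, mem_ofPred_eq, fourier_add_latticePt]⟩

lemma forall_mem_peakSet_of_forall_mem_maxSet {p : E d → Prop}
    (hp : ∀ ξ m, p ξ → p (ξ + (2 * Real.pi) • latticePt m)) (h : ∀ ξ ∈ maxSet φ, p ξ) :
    ∀ ξ ∈ peakSet φ, p ξ := by
  intro ξ hξ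
  obtain ⟨m, hm⟩ := exists_add_latticePt_mem_maxSet hξ
  have hneg : latticePt (-m) = -latticePt m := by
    ext i
    simp [latticePt]
  simpa only [hneg, smul_neg, add_neg_cancel_right] using hp _ (-m) (h _ hm)

lemma isDiscrete_peakSet (h : ∀ ξ ∈ maxSet φ, ∀ᶠ η in 𝓝[≠] ξ, ‖fourier φ η‖ < 1) :
    IsDiscrete (peakSet φ) := by
  have hiso : ∀ ξ ∈ peakSet φ, ∀ᶠ η in 𝓝[≠] ξ, ‖fourier φ η‖ < 1 := by
    refine forall_mem_peakSet_of_forall_mem_maxSet (fun ξ m hξ => ?_) h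
    rw [← map_add_right_nhdsNE, eventually_map]
    simpa only [fourier_add_latticePt] using hξ
  refine isDiscrete_iff_nhdsNE.2 fun ξ hξ => ?_
  rw [← disjoint_iff, disjoint_principal_right]
  exact (hiso ξ hξ).mono fun η hη => hη.ne

lemma finite_inter_peakSet (hc : Continuous (fourier φ)) (hd : IsDiscrete (peakSet φ))
    {K : Set (E d)} (hK : IsCompact K) : (K ∩ peakSet φ).Finite :=
  (hK.inter_right (isClosed_peakSet hc)).finite (hd.mono inter_subset_right)

lemma finite_closure_cube_inter_peakSet (hc : Continuous (fourier φ))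
    (hd : IsDiscrete (peakSet φ)) (a : Fin d → ℝ) : (closure (cube a) ∩ peakSet φ).Finite :=
  finite_inter_peakSet hc hd (isBounded_cube a).isCompact_closure

lemma finite_maxSet (hc : Continuous (fourier φ)) (hd : IsDiscrete (peakSet φ)) :
    (maxSet φ).Finite := by
  rw [maxSet_eq_cube_inter_peakSet]
  exact (finite_closure_cube_inter_peakSet hc hd 0).subset
    (inter_subset_inter_left _ subset_closure)

lemma maxSet_nonempty (hc : Continuous (fourier φ))
    (hsup : IsLUB (range fun ξ : E d => ‖fourier φ ξ‖) 1) : (maxSet φ).Nonempty := by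
  obtain ⟨m, hm⟩ := exists_add_latticePt_mem_cube (0 : Fin d → ℝ) 0
  obtain ⟨ξ, -, hξ⟩ := (isBounded_cube (0 : Fin d → ℝ)).isCompact_closure.exists_isMaxOn
    ⟨_, subset_closure hm⟩ hc.norm.continuousOn
  have hub (η : E d) : ‖fourier φ η‖ ≤ ‖fourier φ ξ‖ := by
    obtain ⟨m, hm⟩ := exists_add_latticePt_mem_cube 0 η
    rw [← fourier_add_latticePt φ m η]
    exact hξ (subset_closure hm)
  have hpeak : ξ ∈ peakSet φ :=
    le_antisymm (hsup.1 (mem_range_self ξ)) (hsup.2 (forall_mem_range.2 hub))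
  exact (exists_add_latticePt_mem_maxSet hpeak).imp' _ fun _ => id

lemma exists_closure_cube_inter_peakSet_subset (hcount : (peakSet φ).Countable) :
    ∃ a : Fin d → ℝ, closure (cube a) ∩ peakSet φ ⊆ interior (cube a) := by
  have hcoord (i : Fin d) : ∃ c : ℝ, ∀ ξ ∈ peakSet φ, ξ i ≠ c - Real.pi ∧ ξ i ≠ c + Real.pi := by
    obtain ⟨c, hc⟩ := (((hcount.image fun ξ => ξ i + Real.pi).union
      (hcount.image fun ξ => ξ i - Real.pi)).dense_compl ℝ).nonempty
    refine ⟨c, fun ξ hξ => ⟨fun h => hc (Or.inl ⟨ξ, hξ, ?_⟩), fun h => hc (Or.inr ⟨ξ, hξ, ?_⟩)⟩⟩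
    · simp only [h, sub_add_cancel]
    · simp only [h, add_sub_cancel_right]
  choose a ha using hcoord
  refine ⟨a, fun ξ hξ => setOf_forall_mem_Ioo_subset_interior_cube a fun i => ?_⟩
  have hmem := closure_cube_subset a hξ.1 i
  exact ⟨hmem.1.lt_of_ne (ha i ξ hξ.2).1.symm, hmem.2.lt_of_ne (ha i ξ hξ.2).2⟩

end Periodicity

section Global

variable {d : ℕ} {φ : (Fin d → ℤ) → ℂ} {μ : ℝ} {x : Fin d → ℤ} {S Z : Set (E d)}

lemma exists_isOpen_norm_setIntegral_inversionKernel_le (hZ : Z.Finite) (hZO : Z ⊆ interior S)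
    (hint : ∀ n, IntegrableOn (inversionKernel φ n x) S)
    (hdec : ∀ ξ ∈ Z, HasLocalDecay φ x ξ μ) :
    ∃ T ⊆ S, IsOpen T ∧ Z ⊆ T ∧ ∃ C : ℝ, ∀ n : ℕ, 1 ≤ n →
      ‖∫ ξ in T, inversionKernel φ n x ξ‖ ≤ C * (n : ℝ) ^ (-μ) := by
  obtain ⟨O, hO, hdisj⟩ := hZ.t2_separation
  choose! N hN hNo hmem C hC using fun ξ (hξ : ξ ∈ Z) => hdec ξ hξ (O ξ ∩ interior S)
    (inter_mem ((hO ξ).2.mem_nhds (hO ξ).1) (isOpen_interior.mem_nhds (hZO hξ)))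
  have hNS (ξ : Z) : N ξ ⊆ S := (hN ξ ξ.2).trans (inter_subset_right.trans interior_subset)
  have : Fintype Z := hZ.fintype
  have hNdisj : Pairwise (Function.onFun Disjoint fun ξ : Z => N ξ) := fun ξ η hne =>
    (hdisj ξ.2 η.2 (Subtype.coe_injective.ne hne)).mono ((hN ξ ξ.2).trans inter_subset_left)
      ((hN η η.2).trans inter_subset_left)
  refine ⟨⋃ ξ : Z, N ξ, iUnion_subset hNS, isOpen_iUnion fun ξ => hNo ξ ξ.2,
    fun ξ hξ => mem_iUnion.2 ⟨⟨ξ, hξ⟩, hmem ξ hξ⟩, ∑ ξ : Z, C ξ, fun n hn => ?_⟩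
  rw [integral_iUnion_fintype (fun ξ : Z => (hNo ξ ξ.2).measurableSet) hNdisj
    fun ξ : Z => (hint n).mono_set (hNS ξ), Finset.sum_mul]
  exact norm_sum_le_of_le _ fun ξ _ => hC ξ ξ.2 n hn

lemma exists_pow_le_mul_rpow {ρ : ℝ} (hρ₀ : 0 ≤ ρ) (hρ : ρ < 1) (μ : ℝ) :
    ∃ C : ℝ, ∀ n : ℕ, 1 ≤ n → ρ ^ n ≤ C * (n : ℝ) ^ (-μ) := by
  obtain ⟨k, hk⟩ := exists_nat_ge μ
  obtain ⟨C, hC⟩ := (tendsto_pow_const_mul_const_pow_of_abs_lt_one k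
    (by rwa [abs_of_nonneg hρ₀])).bddAbove_range
  refine ⟨C, fun n hn => ?_⟩
  have hn1 : (1 : ℝ) ≤ n := by exact_mod_cast hn
  have hn0 : (0 : ℝ) < n := one_pos.trans_le hn1
  rw [Real.rpow_neg hn0.le, ← div_eq_mul_inv, le_div_iff₀' (by positivity)]
  calc (n : ℝ) ^ μ * ρ ^ n ≤ (n : ℝ) ^ (k : ℝ) * ρ ^ n := by gcongr
    _ = (n : ℝ) ^ k * ρ ^ n := by rw [Real.rpow_natCast]
    _ ≤ C := hC (mem_range_self n)

lemma exists_norm_setIntegral_inversionKernel_le_of_norm_fourier_lt_one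
    (hc : Continuous (fourier φ)) {K : Set (E d)} (hK : IsCompact K)
    (hlt : ∀ ξ ∈ K, ‖fourier φ ξ‖ < 1) (hS : S ⊆ K) (μ : ℝ) (x : Fin d → ℤ) :
    ∃ C : ℝ, ∀ n : ℕ, 1 ≤ n →
      ‖∫ ξ in S, inversionKernel φ n x ξ‖ ≤ C * (n : ℝ) ^ (-μ) := by
  obtain ⟨ρ, hρ₀, hρ, hle⟩ : ∃ ρ : ℝ, 0 ≤ ρ ∧ ρ < 1 ∧ ∀ ξ ∈ K, ‖fourier φ ξ‖ ≤ ρ := by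
    rcases K.eq_empty_or_nonempty with rfl | hne
    · exact ⟨0, le_rfl, one_pos, fun _ h => h.elim⟩
    · obtain ⟨ξ, hξ, hmax⟩ := hK.exists_isMaxOn hne hc.norm.continuousOn
      exact ⟨_, norm_nonneg _, hlt ξ hξ, hmax⟩
  obtain ⟨C, hC⟩ := exists_pow_le_mul_rpow hρ₀ hρ μ
  refine ⟨C * volume.real S, fun n hn => ?_⟩
  have hfin : volume S < ⊤ := (measure_mono hS).trans_lt hK.measure_lt_top
  have hker (ξ : E d) (hξ : ξ ∈ S) : ‖inversionKernel φ n x ξ‖ ≤ C * (n : ℝ) ^ (-μ) := by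
    rw [norm_inversionKernel]
    exact (pow_le_pow_left₀ (norm_nonneg _) (hle ξ (hS hξ)) n).trans (hC n hn)
  calc ‖∫ ξ in S, inversionKernel φ n x ξ‖ ≤ C * (n : ℝ) ^ (-μ) * volume.real S :=
        norm_setIntegral_le_of_norm_le_const hfin hker
    _ = C * volume.real S * (n : ℝ) ^ (-μ) := mul_right_comm _ _ _

lemma exists_norm_setIntegral_inversionKernel_le (hc : Continuous (fourier φ))
    (hle : ∀ ξ, ‖fourier φ ξ‖ ≤ 1) (hS : Bornology.IsBounded S)
    (hfin : (closure S ∩ peakSet φ).Finite) (hint : closure S ∩ peakSet φ ⊆ interior S)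
    (hdec : ∀ ξ ∈ peakSet φ, HasLocalDecay φ x ξ μ) :
    ∃ C : ℝ, ∀ n : ℕ, 1 ≤ n →
      ‖∫ ξ in S, inversionKernel φ n x ξ‖ ≤ C * (n : ℝ) ^ (-μ) := by
  have hintegrable (n : ℕ) : IntegrableOn (inversionKernel φ n x) S :=
    ((continuous_inversionKernel hc n x).continuousOn.integrableOn_compact
      hS.isCompact_closure).mono_set subset_closure
  obtain ⟨T, hTS, hT, hpeak, C, hC⟩ := exists_isOpen_norm_setIntegral_inversionKernel_le hfin hint
    hintegrable fun ξ hξ => hdec ξ hξ.2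
  have hlt (ξ : E d) (hξ : ξ ∈ closure S \ T) : ‖fourier φ ξ‖ < 1 :=
    (hle ξ).lt_of_ne fun h => hξ.2 (hpeak ⟨hξ.1, h⟩)
  obtain ⟨C', hC'⟩ := exists_norm_setIntegral_inversionKernel_le_of_norm_fourier_lt_one hc
    (hS.isCompact_closure.diff hT) hlt (sdiff_subset_sdiff_left subset_closure) μ x
  refine ⟨C + C', fun n hn => ?_⟩
  rw [← add_sub_cancel (∫ ξ in T, inversionKernel φ n x ξ) (∫ ξ in S, inversionKernel φ n x ξ),
    ← setIntegral_sdiff hT.measurableSet (hintegrable n) hTS, add_mul]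
  exact norm_add_le_of_le (hC n hn) (hC' n hn)

lemma exists_norm_convPow_le (hφ : Summable fun x => ‖φ x‖) (hle : ∀ ξ, ‖fourier φ ξ‖ ≤ 1)
    (hd : IsDiscrete (peakSet φ)) (hdec : ∀ ξ ∈ peakSet φ, HasLocalDecay φ x ξ μ) :
    ∃ C : ℝ, ∀ n : ℕ, 1 ≤ n → ‖convPow φ n x‖ ≤ C * (n : ℝ) ^ (-μ) := by
  have hc := continuous_fourier hφ
  obtain ⟨a, ha⟩ := exists_closure_cube_inter_peakSet_subset
    ((HereditarilyLindelofSpace.isLindelof (peakSet φ)).countable_of_isDiscrete hd)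
  obtain ⟨C, hC⟩ := exists_norm_setIntegral_inversionKernel_le hc hle (isBounded_cube a)
    (finite_closure_cube_inter_peakSet hc hd a) ha hdec
  have hpi : (1 : ℝ) ≤ ‖(2 * Real.pi : ℂ) ^ d‖ := by
    rw [norm_pow, norm_mul, Complex.norm_ofNat, Complex.norm_of_nonneg Real.pi_pos.le]
    exact one_le_pow₀ (by linarith [Real.pi_gt_three])
  refine ⟨C, fun n hn => ?_⟩
  calc ‖convPow φ n x‖ ≤ ‖(2 * Real.pi : ℂ) ^ d‖ * ‖convPow φ n x‖ :=
        le_mul_of_one_le_left (norm_nonneg _) hpi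
    _ = ‖∫ ξ in cube a, inversionKernel φ n x ξ‖ := by
        rw [setIntegral_cube_inversionKernel hφ, norm_mul]
    _ ≤ C * (n : ℝ) ^ (-μ) := hC n hn

lemma finite_latticePt_mem {K : Set (E d)} (hK : IsCompact K) :
    {x : Fin d → ℤ | latticePt x ∈ K}.Finite := by
  obtain ⟨M, hM⟩ := hK.isBounded.exists_norm_le
  refine (finite_Icc (fun _ => -⌈M⌉) fun _ => ⌈M⌉).subset fun x hx => ?_
  have habs (i : Fin d) : |x i| ≤ ⌈M⌉ := by
    have h : |(x i : ℝ)| ≤ ⌈M⌉ :=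
      ((PiLp.norm_apply_le (latticePt x) i).trans (hM _ hx)).trans (Int.le_ceil M)
    exact_mod_cast h
  exact ⟨fun i => (abs_le.1 (habs i)).1, fun i => (abs_le.1 (habs i)).2⟩

lemma exists_forall_latticePt_mem_norm_convPow_le
    (h : ∀ x, ∃ C : ℝ, ∀ n : ℕ, 1 ≤ n → ‖convPow φ n x‖ ≤ C * (n : ℝ) ^ (-μ))
    {K : Set (E d)} (hK : IsCompact K) : ∃ C : ℝ, 0 < C ∧ ∀ x : Fin d → ℤ, latticePt x ∈ K →
      ∀ n : ℕ, 1 ≤ n → ‖convPow φ n x‖ ≤ C / (n : ℝ) ^ μ := by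
  choose C hC using h
  obtain ⟨M, hM⟩ := ((finite_latticePt_mem hK).image C).bddAbove
  refine ⟨max M 1, lt_max_of_lt_right one_pos, fun x hx n hn => (hC x n hn).trans ?_⟩
  rw [div_eq_mul_inv, ← Real.rpow_neg n.cast_nonneg]
  gcongr
  exact le_max_of_le_left (hM (mem_image_of_mem C hx))

end Global

section Order

variable {d : ℕ} {φ : (Fin d → ℤ) → ℂ} {ξ₀ : E d}

lemma hasType_homogeneousOrder
    (h : IsPositiveHomogeneousType φ ξ₀ ∨ IsImaginaryHomogeneousType φ ξ₀) :
    HasPositiveHomogeneousType φ ξ₀ (homogeneousOrder φ ξ₀) ∨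
      HasImaginaryHomogeneousType φ ξ₀ (homogeneousOrder φ ξ₀) := by
  have hex := exists_or.2 h
  rw [homogeneousOrder, dif_pos hex]
  exact hex.choose_spec

lemma isLeast_minOrder (hfin : (maxSet φ).Finite) (hne : (maxSet φ).Nonempty) :
    IsLeast (homogeneousOrder φ '' maxSet φ) (minOrder φ) :=
  ⟨(hne.image _).csInf_mem (hfin.image _),
    fun _ h => csInf_le (hfin.image _).bddBelow h⟩

lemma eventually_norm_fourier_lt_one_of_type (hξ₀ : ξ₀ ∈ maxSet φ)
    (h : IsPositiveHomogeneousType φ ξ₀ ∨ IsImaginaryHomogeneousType φ ξ₀) :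
    ∀ᶠ ξ in 𝓝[≠] ξ₀, ‖fourier φ ξ‖ < 1 := by
  rcases h with ⟨μ, h⟩ | ⟨μ, h⟩
  exacts [h.eventually_norm_fourier_lt_one hξ₀.2, h.eventually_norm_fourier_lt_one hξ₀.2]

lemma hasLocalDecay_homogeneousOrder (hc : Continuous (fourier φ)) (hξ₀ : ξ₀ ∈ maxSet φ)
    (h : IsPositiveHomogeneousType φ ξ₀ ∨ IsImaginaryHomogeneousType φ ξ₀)
    (himag : IsImaginaryHomogeneousType φ ξ₀ → drift φ ξ₀ = 0 ∧ homogeneousOrder φ ξ₀ < 1)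
    (x : Fin d → ℤ) : HasLocalDecay φ x ξ₀ (homogeneousOrder φ ξ₀) := by
  rcases hasType_homogeneousOrder h with h | h
  · exact h.hasLocalDecay hξ₀.2 x
  · obtain ⟨hdrift, hlt⟩ := himag ⟨_, h⟩
    exact h.hasLocalDecay hξ₀.2 hc hdrift hlt x

end Order

end ConvPower

open ConvPower in
theorem theorem3p2_general {d : ℕ} {φ : (Fin d → ℤ) → ℂ} (hφ : Summable fun x => ‖φ x‖)
    (hsup : IsLUB (Set.range fun ξ : E d => ‖fourier φ ξ‖) 1)
    (htype : ∀ ξ₀ ∈ maxSet φ, IsPositiveHomogeneousType φ ξ₀ ∨ IsImaginaryHomogeneousType φ ξ₀)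
    (himag : ∀ ξ₀ ∈ maxSet φ, IsImaginaryHomogeneousType φ ξ₀ →
      drift φ ξ₀ = 0 ∧ homogeneousOrder φ ξ₀ < 1) :
    (maxSet φ).Finite ∧ IsLeast (homogeneousOrder φ '' maxSet φ) (minOrder φ) ∧
    ∀ K : Set (E d), IsCompact K →
      ∃ C : ℝ, 0 < C ∧ ∀ x : Fin d → ℤ, latticePt x ∈ K → ∀ n : ℕ, 1 ≤ n →
        ‖convPow φ n x‖ ≤ C / (n : ℝ) ^ minOrder φ := by
  have hc : Continuous (fourier φ) := continuous_fourier hφ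
  have hdisc : IsDiscrete (peakSet φ) := isDiscrete_peakSet fun ξ₀ hξ₀ =>
    eventually_norm_fourier_lt_one_of_type hξ₀ (htype ξ₀ hξ₀)
  have hfin : (maxSet φ).Finite := finite_maxSet hc hdisc
  have hmin := isLeast_minOrder hfin (maxSet_nonempty hc hsup)
  have hdec (x : Fin d → ℤ) : ∀ ξ ∈ peakSet φ, HasLocalDecay φ x ξ (minOrder φ) :=
    forall_mem_peakSet_of_forall_mem_maxSet (fun _ m h => h.add_latticePt m) fun ξ₀ hξ₀ =>
      (hasLocalDecay_homogeneousOrder hc hξ₀ (htype ξ₀ hξ₀) (himag ξ₀ hξ₀) x).mono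
        (hmin.2 (Set.mem_image_of_mem _ hξ₀))
  exact ⟨hfin, hmin, fun K hK => exists_forall_latticePt_mem_norm_convPow_le (fun x =>
    exists_norm_convPow_le hφ (fun ξ => hsup.1 (Set.mem_range_self ξ)) hdisc (hdec x)) hK⟩

theorem theorem3p2 (d : ℕ) (hd : 1 ≤ d) (φ : (Fin d → ℤ) → ℂ) (hφ : ConvPower.MemS φ)
    (hsup : IsLUB (Set.range fun ξ : ConvPower.E d => ‖ConvPower.fourier φ ξ‖) 1)
    (htype : ∀ ξ₀ ∈ ConvPower.maxSet φ,
      ConvPower.IsPositiveHomogeneousType φ ξ₀ ∨ ConvPower.IsImaginaryHomogeneousType φ ξ₀)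
    (himag : ∀ ξ₀ ∈ ConvPower.maxSet φ, ConvPower.IsImaginaryHomogeneousType φ ξ₀ →
      ConvPower.drift φ ξ₀ = 0 ∧ ConvPower.homogeneousOrder φ ξ₀ < 1) :
    (ConvPower.maxSet φ).Finite ∧
    IsLeast (ConvPower.homogeneousOrder φ '' ConvPower.maxSet φ) (ConvPower.minOrder φ) ∧
    ∀ K : Set (ConvPower.E d), IsCompact K →
      ∃ C : ℝ, 0 < C ∧ ∀ x : Fin d → ℤ, ConvPower.latticePt x ∈ K → ∀ n : ℕ, 1 ≤ n →
        ‖ConvPower.convPow φ n x‖ ≤ C / (n : ℝ) ^ ConvPower.minOrder φ :=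
  theorem3p2_general hφ.summable_norm hsup htype himag
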